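/- Let $\mathcal H$ be a finite-dimensional complex Hilbert space, let $\mathcal B(\mathcal H)$ be the space of linear operators on $\mathcal H$ with the Hilbert--Schmidt inner product $\langle X,Y\rangle_{HS}=\operatorname{tr}XY^*$, and let $\mathcal B(\mathcal H)^+$ be the cone of positive semidefinite operators. For a self-adjoint operator $T$ on a finite-dimensional complex inner product space with spectral decomposition $T=\sum_{a\in\sigma(T)}aP_a$, and a real function $g$ defined on $\sigma(T)$, write $g(T)=\sum_{a\in\sigma(T)}g(a)P_a$. Let $f:[0,\infty)\to\mathbb R$. For $A,B\in\mathcal B(\mathcal H)^+$ the quantum $f$-divergence $S_f(A\|B)\in[-\infty,\infty]$ is $$S_f(A\|B)=\big\langle B^{1/2},\,f(L_AR_{B^{-1}})\,B^{1/2}\big\rangle_{HS}\quad\text{if }\operatorname{supp}A\subseteq\operatorname{supp}B,$$ where $B^{-1}$ is the inverse of $B$ on its support $\operatorname{supp}B=(\ker B)^\perp$, extended by $0$ to $\ker B$, and $L_AR_{B^{-1}}$ is the operator $X\mapsto AXB^{-1}$ on $\mathcal B(\mathcal H)$ (it is self-adjoint and positive semidefinite with respect to $\langle\cdot,\cdot\rangle_{HS}$);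 and $$S_f(A\|B)=\lim_{\varepsilon\downarrow0}S_f(A\|B+\varepsilon I)\quad\text{if }\operatorname{supp}A\not\subseteq\operatorname{supp}B.$$ (For strictly convex $f$ the limit always exists in $[-\infty,\infty]$.) **Theorem.** Let $f:[0,\infty)\to\mathbb R$ be strictly convex, and let $\phi:\mathcal B(\mathcal H)^+\to\mathcal B(\mathcal H)^+$ be a bijection such that $$S_f(\phi(A)\|\phi(B))=S_f(A\|B)\qquad\text{for all }A,B\in\mathcal B(\mathcal H)^+.$$ Then there is a unitary or antiunitary operator $U:\mathcal H\to\mathcal H$ such that $\phi(A)=UAU^*$ for all $A\in\mathcal B(\mathcal H)^+$. -/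

import Mathlib

noncomputable section

namespace QuantumFDiv

open Filter Topology

section OperatorFunction

variable {V : Type*} [NormedAddCommGroup V] [InnerProductSpace ℂ V] [FiniteDimensional ℂ V]

/-- The standard operator function `f(T) = ∑_{a ∈ σ(T)} f(a) P_a` of a self-adjoint operator `T` on
a finite-dimensional complex inner product space, where `P_a` is the orthogonal projection onto the
eigenspace of the eigenvalue `a` (eigenvalues of a self-adjoint operator are real, so that taking
the real part only changes their type). -/
def opFun (f : ℝ → ℝ) (T : V →ₗ[ℂ] V) : V →ₗ[ℂ] V :=
  ∑ a ∈ (Module.End.finite_spectrum T).toFinset,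
    ((f a.re : ℝ) : ℂ) • ((Module.End.eigenspace T a).starProjection : V →ₗ[ℂ] V)

end OperatorFunction

variable {H : Type*} [NormedAddCommGroup H] [InnerProductSpace ℂ H] [FiniteDimensional ℂ H]

/-- The Hilbert-Schmidt inner product `⟨X, Y⟩_HS = tr (X Y*)` on the space of linear operators. It
is linear in `X`; Mathlib's inner products are linear in the second variable, so that
`inner ℂ X Y = ⟨Y, X⟩_HS`. -/
@[reducible] def hsCore : InnerProductSpace.Core ℂ (H →ₗ[ℂ] H) where
  inner X Y := LinearMap.trace ℂ H (Y * LinearMap.adjoint X)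
  conj_inner_symm X Y := by
    simp only [LinearMap.trace_eq_sum_inner _ (stdOrthonormalBasis ℂ H), map_sum,
      inner_conj_symm, Module.End.mul_apply]
    refine Finset.sum_congr rfl fun i _ => ?_
    rw [← LinearMap.adjoint_inner_right, LinearMap.adjoint_inner_left]
  re_inner_nonneg X := by
    rw [LinearMap.trace_eq_sum_inner _ (stdOrthonormalBasis ℂ H), map_sum]
    refine Finset.sum_nonneg fun i _ => ?_
    rw [Module.End.mul_apply, ← LinearMap.adjoint_inner_left]
    exact inner_self_nonneg
  add_left X Y Z := by simp [mul_add]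
  smul_left X Y r := by
    rw [map_smulₛₗ, mul_smul_comm, map_smul, smul_eq_mul]
  definite X hX := by
    rw [LinearMap.trace_eq_sum_inner _ (stdOrthonormalBasis ℂ H)] at hX
    have h1 : ∀ i, LinearMap.adjoint X (stdOrthonormalBasis ℂ H i) = 0 := by
      have h2 : ∑ i, ‖LinearMap.adjoint X (stdOrthonormalBasis ℂ H i)‖ ^ 2 = 0 := by
        have h3 := congrArg Complex.re hX
        rw [Complex.re_sum, Complex.zero_re] at h3
        rw [← h3]
        refine Finset.sum_congr rfl fun i _ => ?_
        rw [Module.End.mul_apply, ← LinearMap.adjoint_inner_left]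
        exact (inner_self_eq_norm_sq (𝕜 := ℂ) _).symm
      intro i
      have h4 := (Finset.sum_eq_zero_iff_of_nonneg (fun i _ => by positivity)).1 h2 i
        (Finset.mem_univ i)
      simpa using h4
    have h5 : LinearMap.adjoint X = 0 :=
      (stdOrthonormalBasis ℂ H).toBasis.ext fun i => by simpa using h1 i
    simpa using congrArg LinearMap.adjoint h5

/-- The space of linear operators on `H` with the Hilbert-Schmidt norm. -/
instance hsNormedAddCommGroup : NormedAddCommGroup (H →ₗ[ℂ] H) :=
  hsCore.toNormedAddCommGroup

/-- The space of linear operators on `H` with the Hilbert-Schmidt inner product. -/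
instance hsInnerProductSpace : InnerProductSpace ℂ (H →ₗ[ℂ] H) :=
  InnerProductSpace.ofCore hsCore.toCore

/-- The support of a self-adjoint operator: the orthogonal complement of its kernel. -/
def supp (A : H →ₗ[ℂ] H) : Submodule ℂ H := (LinearMap.ker A)ᗮ

/-- The superoperator `L_A R_{B⁻¹} : X ↦ A X B⁻¹` on the space of operators, where `B⁻¹` is the
inverse of the positive semidefinite operator `B` on its support, extended by `0` to the kernel
(`(0 : ℝ)⁻¹ = 0`). -/
def relModular (A B : H →ₗ[ℂ] H) : (H →ₗ[ℂ] H) →ₗ[ℂ] (H →ₗ[ℂ] H) :=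
  LinearMap.mulLeft ℂ A ∘ₗ LinearMap.mulRight ℂ (opFun (fun x => x⁻¹) B)

/-- The real number `⟨B^{1/2}, f(L_A R_{B⁻¹}) B^{1/2}⟩_HS`. -/
def quasiEntropy (f : ℝ → ℝ) (A B : H →ₗ[ℂ] H) : ℝ :=
  (inner ℂ (opFun f (relModular A B) (opFun Real.sqrt B)) (opFun Real.sqrt B)).re

open Classical in
/-- The quantum `f`-divergence `S_f(A‖B) ∈ [-∞, ∞]` of positive semidefinite operators: it is
`⟨B^{1/2}, f(L_A R_{B⁻¹}) B^{1/2}⟩_HS` if `supp A ⊆ supp B`, and the limit of `S_f(A‖B + εI)` as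
`ε ↓ 0` otherwise (`B + εI` is invertible for `ε > 0`, so that the first case applies to it). -/
def fDiv (f : ℝ → ℝ) (A B : H →ₗ[ℂ] H) : EReal :=
  if supp A ≤ supp B then ((quasiEntropy f A B : ℝ) : EReal)
  else limUnder (𝓝[>] (0 : ℝ)) fun ε : ℝ =>
    ((quasiEntropy f A (B + (ε : ℂ) • (1 : H →ₗ[ℂ] H)) : ℝ) : EReal)

variable (H) in
/-- The cone of positive semidefinite operators on `H`. -/
abbrev PSD : Type _ := {A : H →ₗ[ℂ] H // A.IsPositive}

end QuantumFDiv

end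

noncomputable section

namespace QuantumFDiv

open Filter Topology

/-! ### The divergence in eigenbases -/

section EigenbasisFormula

/-! In eigenbases `e`, `g` of `A`, `B` with eigenvalues `α`, `β`, the divergence is the sum of the
perspectives `β j * f (α i / β j)` weighted by `‖⟨e i, g j⟩‖ ^ 2`, a doubly stochastic array. When
`β j = 0` the perspective becomes `ω * α i`, with `ω` the limit of `f x / x`; if that limit is
infinite, the divergence is `⊤` as soon as the supports are not nested (`fDiv_of_tendsto`,
`fDiv_of_tendsto_atTop`). Everything else is extracted from this formula.

The map fixes `0`, because `0` has a property stated through the divergence alone (`map_zero_eq`).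
It then preserves the trace, since one of the values at `(0, B)`, `(B, B)`, `(B, 0)`, or the infimum
over the first argument, is a nonzero multiple of `rtr B` (`rtr_map`). Given traces, the condition
`B ≥ I` is an upper bound on the divergences of trace-one operators relative to `B`
(`one_le_eigenvalues_iff`), so `I` is fixed. Among the `B ≥ I` of trace `dim H + 1`, strict
convexity makes `I + |y⟩⟨y|` with `y` a unit vector the only maximizers of `tr f(B)`, the divergence
of `B` relative to `I`; hence this family is mapped to itself.

On the family the divergence is an injective function of `‖⟨x, y⟩‖`, so the induced map of unit
vectors is a Wigner symmetry, implemented by some `U` up to phases (`wigner`). Finally, replacing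
`I` by `I + |y⟩⟨y|` in the second argument changes the divergence by `⟨y, k(A) y⟩` with `k a = 2 * f
(a / 2) - f a`. As `k` is strictly decreasing, these numbers determine `A` (`eq_conj_of_fDiv_eq`).
-/

lemma opFun_apply_of_eigen {V : Type*} [NormedAddCommGroup V] [InnerProductSpace ℂ V]
    [FiniteDimensional ℂ V] (f : ℝ → ℝ) {T : V →ₗ[ℂ] V} (hT : T.IsSymmetric) {a : ℝ} {x : V}
    (hx : T x = (a : ℂ) • x) : opFun f T x = ((f a : ℝ) : ℂ) • x := by
  rcases eq_or_ne x 0 with rfl | hx0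
  · simp
  have hmem : x ∈ Module.End.eigenspace T (a : ℂ) := Module.End.mem_eigenspace_iff.2 hx
  have hspec : (a : ℂ) ∈ spectrum ℂ T :=
    (Module.End.hasEigenvalue_of_hasEigenvector ⟨hmem, hx0⟩).mem_spectrum
  rw [opFun, LinearMap.sum_apply, Finset.sum_eq_single (a : ℂ)]
  · rw [LinearMap.smul_apply, Complex.ofReal_re]
    congr 1
    exact Submodule.starProjection_eq_self_iff.2 hmem
  · intro b _ hb
    rw [LinearMap.smul_apply]
    have h0 : (Module.End.eigenspace T b).starProjection x = 0 := by
      rw [Submodule.starProjection_apply_eq_zero_iff, Submodule.mem_orthogonal]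
      intro y hy
      exact hT.orthogonalFamily_eigenspaces hb ⟨y, hy⟩ ⟨x, hmem⟩
    rw [ContinuousLinearMap.coe_coe, h0, smul_zero]
  · intro h
    exact absurd ((Set.Finite.mem_toFinset _).2 hspec) h

variable {H : Type*} [NormedAddCommGroup H] [InnerProductSpace ℂ H]

/-- `A = ∑ i, α i |e i⟩⟨e i|` with nonnegative eigenvalues `α`. -/
structure Diag {ι : Type*} [Fintype ι] (A : H →ₗ[ℂ] H) (e : OrthonormalBasis ι ℂ H)
    (α : ι → ℝ) : Prop where
  nonneg : ∀ i, 0 ≤ α i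
  apply : ∀ i, A (e i) = (α i : ℂ) • e i

variable {ι κ : Type*} [Fintype ι] [Fintype κ]

lemma Diag.inner_apply {A : H →ₗ[ℂ] H} {e : OrthonormalBasis ι ℂ H} {α : ι → ℝ} (h : Diag A e α)
    (i : ι) (x : H) : inner ℂ (e i) (A x) = α i * inner ℂ (e i) x := by
  classical
  conv_lhs => rw [← e.sum_repr x]
  simp only [map_sum, map_smul, h.apply, inner_sum, inner_smul_right, e.repr_apply_apply,
    e.inner_eq_ite]
  simp [mul_comm]

lemma Diag.isSymmetric {A : H →ₗ[ℂ] H} {e : OrthonormalBasis ι ℂ H} {α : ι → ℝ}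
    (h : Diag A e α) : A.IsSymmetric := by
  intro x y
  rw [← e.sum_inner_mul_inner (A x) y, ← e.sum_inner_mul_inner x (A y)]
  refine Finset.sum_congr rfl fun i _ => ?_
  rw [h.inner_apply, ← inner_conj_symm, h.inner_apply, map_mul, inner_conj_symm, Complex.conj_ofReal]
  ring

lemma Diag.isPositive {A : H →ₗ[ℂ] H} {e : OrthonormalBasis ι ℂ H} {α : ι → ℝ}
    (h : Diag A e α) : A.IsPositive := by
  refine ⟨h.isSymmetric, fun x => ?_⟩
  rw [← e.sum_inner_mul_inner (A x) x, map_sum]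
  refine Finset.sum_nonneg fun i _ => ?_
  have h1 : inner ℂ (A x) (e i) * inner ℂ (e i) x = ((α i * ‖inner ℂ (e i) x‖ ^ 2 : ℝ) : ℂ) := by
    rw [← inner_conj_symm, h.inner_apply, map_mul, Complex.conj_ofReal, mul_assoc,
      Complex.conj_mul']
    push_cast
    rfl
  rw [h1]
  exact mul_nonneg (h.nonneg i) (by positivity)

/-- The real trace. -/
def rtr (A : H →ₗ[ℂ] H) : ℝ := (LinearMap.trace ℂ H A).re

/-- The rank one operator `|u⟩⟨v|`. -/
def ketbra (u v : H) : H →ₗ[ℂ] H := (innerₛₗ ℂ v).smulRight u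

@[simp] lemma ketbra_apply (u v x : H) : ketbra u v x = inner ℂ v x • u := rfl

lemma Diag.add_smul_one {B : H →ₗ[ℂ] H} {f : OrthonormalBasis κ ℂ H} {β : κ → ℝ}
    (hB : Diag B f β) {ε : ℝ} (hε : 0 ≤ ε) :
    Diag (B + (ε : ℂ) • (1 : H →ₗ[ℂ] H)) f (fun j => β j + ε) :=
  ⟨fun j => add_nonneg (hB.nonneg j) hε, fun j => by simp [hB.apply, add_smul]⟩

lemma Diag.smul {B : H →ₗ[ℂ] H} {f : OrthonormalBasis κ ℂ H} {β : κ → ℝ}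
    (hB : Diag B f β) {c : ℝ} (hc : 0 ≤ c) : Diag ((c : ℂ) • B) f (fun j => c * β j) :=
  ⟨fun j => mul_nonneg hc (hB.nonneg j), fun j => by simp [hB.apply, mul_smul]⟩

lemma diag_zero (f : OrthonormalBasis κ ℂ H) : Diag (0 : H →ₗ[ℂ] H) f (fun _ => 0) :=
  ⟨fun _ => le_rfl, fun j => by simp⟩

lemma diag_one (f : OrthonormalBasis κ ℂ H) : Diag (1 : H →ₗ[ℂ] H) f (fun _ => 1) :=
  ⟨fun _ => zero_le_one, fun j => by simp⟩

lemma Diag.ext {A B : H →ₗ[ℂ] H} {f : OrthonormalBasis κ ℂ H} {β : κ → ℝ}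
    (hA : Diag A f β) (hB : Diag B f β) : A = B :=
  f.toBasis.ext fun j => by simp [hA.apply, hB.apply]

lemma sum_weight_right (e : OrthonormalBasis ι ℂ H) (f : OrthonormalBasis κ ℂ H) (i : ι) :
    ∑ j, ‖inner ℂ (e i) (f j)‖ ^ 2 = 1 := by
  rw [f.sum_sq_norm_inner_left, e.norm_eq_one, one_pow]

lemma sum_weight_left (e : OrthonormalBasis ι ℂ H) (f : OrthonormalBasis κ ℂ H) (j : κ) :
    ∑ i, ‖inner ℂ (e i) (f j)‖ ^ 2 = 1 := by
  rw [e.sum_sq_norm_inner_right, f.norm_eq_one, one_pow]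

lemma Diag.rtr_eq {A : H →ₗ[ℂ] H} {e : OrthonormalBasis ι ℂ H} {α : ι → ℝ}
    (h : Diag A e α) : rtr A = ∑ i, α i := by
  rw [rtr, LinearMap.trace_eq_sum_inner _ e, Complex.re_sum]
  refine Finset.sum_congr rfl fun i _ => ?_
  simp [h.inner_apply]

variable [FiniteDimensional ℂ H]

lemma exists_diag {A : H →ₗ[ℂ] H} (hA : A.IsPositive) :
    ∃ (e : OrthonormalBasis (Fin (Module.finrank ℂ H)) ℂ H) (α : _ → ℝ), Diag A e α :=
  ⟨hA.isSymmetric.eigenvectorBasis rfl, hA.isSymmetric.eigenvalues rfl,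
    hA.nonneg_eigenvalues rfl, hA.isSymmetric.apply_eigenvectorBasis rfl⟩

lemma hs_inner_eq (f : OrthonormalBasis ι ℂ H) (X Y : H →ₗ[ℂ] H) :
    inner ℂ X Y = ∑ j, inner ℂ (X (f j)) (Y (f j)) := by
  change LinearMap.trace ℂ H (Y * LinearMap.adjoint X) = _
  rw [LinearMap.trace_mul_comm, LinearMap.trace_eq_sum_inner _ f]
  refine Finset.sum_congr rfl fun i _ => ?_
  rw [Module.End.mul_apply, LinearMap.adjoint_inner_right]

lemma Diag.opFun_apply {A : H →ₗ[ℂ] H} {e : OrthonormalBasis ι ℂ H} {α : ι → ℝ}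
    (h : Diag A e α) (g : ℝ → ℝ) (i : ι) : opFun g A (e i) = ((g (α i) : ℝ) : ℂ) • e i :=
  opFun_apply_of_eigen g h.isSymmetric (h.apply i)

lemma relModular_isSymmetric {A B : H →ₗ[ℂ] H} {e : OrthonormalBasis ι ℂ H} {α : ι → ℝ}
    {f : OrthonormalBasis κ ℂ H} {β : κ → ℝ} (hA : Diag A e α) (hB : Diag B f β) :
    (relModular A B).IsSymmetric := by
  intro X Y
  rw [hs_inner_eq f, hs_inner_eq f]
  refine Finset.sum_congr rfl fun j _ => ?_
  simp only [relModular, LinearMap.comp_apply, LinearMap.mulLeft_apply, LinearMap.mulRight_apply,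
    Module.End.mul_apply, hB.opFun_apply, map_smul, inner_smul_left, inner_smul_right,
    Complex.conj_ofReal]
  rw [hA.isSymmetric]

/-- These rank one operators diagonalize the superoperator. The convention `a / 0 = 0` matches the
inverse extended by `0` to the kernel, so zero eigenvalues of `B` need no separate case. -/
lemma relModular_ketbra {A B : H →ₗ[ℂ] H} {e : OrthonormalBasis ι ℂ H} {α : ι → ℝ}
    {f : OrthonormalBasis κ ℂ H} {β : κ → ℝ} (hA : Diag A e α) (hB : Diag B f β) (i : ι) (j : κ) :
    relModular A B (ketbra (e i) (f j)) = ((α i / β j : ℝ) : ℂ) • ketbra (e i) (f j) := by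
  classical
  refine f.toBasis.ext fun k => ?_
  simp only [relModular, LinearMap.comp_apply, LinearMap.mulLeft_apply, LinearMap.mulRight_apply,
    Module.End.mul_apply, OrthonormalBasis.coe_toBasis, hB.opFun_apply, map_smul, ketbra_apply,
    hA.apply, LinearMap.smul_apply, f.inner_eq_ite]
  split_ifs with h
  · subst h
    rw [one_smul, one_smul, smul_smul]
    push_cast
    congr 1
    ring
  · simp

lemma sqrt_eq_sum_ketbra {B : H →ₗ[ℂ] H} (e : OrthonormalBasis ι ℂ H)
    {f : OrthonormalBasis κ ℂ H} {β : κ → ℝ} (hB : Diag B f β) :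
    opFun Real.sqrt B =
      ∑ j, ∑ i, ((√(β j) : ℝ) * inner ℂ (e i) (f j) : ℂ) • ketbra (e i) (f j) := by
  classical
  refine f.toBasis.ext fun k => ?_
  simp only [OrthonormalBasis.coe_toBasis, hB.opFun_apply, LinearMap.sum_apply,
    LinearMap.smul_apply, ketbra_apply, f.inner_eq_ite]
  rw [Finset.sum_eq_single k]
  · simp only [if_true, one_smul, mul_smul, ← Finset.smul_sum]
    congr 1
    exact (e.sum_repr' (f k)).symm
  · intro j _ hj
    simp [hj]
  · simp

lemma quasiEntropy_eq (g : ℝ → ℝ) {A B : H →ₗ[ℂ] H} {e : OrthonormalBasis ι ℂ H} {α : ι → ℝ}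
    {f : OrthonormalBasis κ ℂ H} {β : κ → ℝ} (hA : Diag A e α) (hB : Diag B f β) :
    quasiEntropy g A B = ∑ i, ∑ j, β j * g (α i / β j) * ‖inner ℂ (e i) (f j)‖ ^ 2 := by
  classical
  have h1 : opFun g (relModular A B) (opFun Real.sqrt B) =
      ∑ j, ∑ i, ((√(β j) : ℝ) * inner ℂ (e i) (f j) : ℂ) •
        ((g (α i / β j) : ℝ) : ℂ) • ketbra (e i) (f j) := by
    conv_lhs => rw [sqrt_eq_sum_ketbra e hB]
    simp only [map_sum, map_smul]
    refine Finset.sum_congr rfl fun j _ => Finset.sum_congr rfl fun i _ => ?_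
    rw [opFun_apply_of_eigen g (relModular_isSymmetric hA hB) (relModular_ketbra hA hB i j)]
  have h2 : ∀ k, opFun g (relModular A B) (opFun Real.sqrt B) (f k) =
      ∑ i, ((√(β k) : ℝ) * inner ℂ (e i) (f k) * (g (α i / β k) : ℝ) : ℂ) • e i := by
    intro k
    rw [h1]
    simp only [LinearMap.sum_apply, LinearMap.smul_apply, ketbra_apply, f.inner_eq_ite]
    rw [Finset.sum_eq_single k]
    · simp only [if_true, one_smul, smul_smul]
    · intro j _ hj
      simp [hj]
    · simp
  rw [quasiEntropy, hs_inner_eq f, Finset.sum_comm, Complex.re_sum]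
  refine Finset.sum_congr rfl fun j _ => ?_
  rw [h2, hB.opFun_apply, sum_inner, Complex.re_sum]
  refine Finset.sum_congr rfl fun i _ => ?_
  rw [inner_smul_left, inner_smul_right, map_mul, map_mul, Complex.conj_ofReal, Complex.conj_ofReal]
  have h3 : ((√(β j) : ℝ) * (starRingEnd ℂ) (inner ℂ (e i) (f j)) * (g (α i / β j) : ℝ) *
      ((√(β j) : ℝ) * inner ℂ (e i) (f j)) : ℂ) =
      ((√(β j) * √(β j) * g (α i / β j) * ‖inner ℂ (e i) (f j)‖ ^ 2 : ℝ) : ℂ) := by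
    push_cast
    rw [← Complex.conj_mul']
    ring
  rw [h3, Complex.ofReal_re, Real.mul_self_sqrt (hB.nonneg j)]

lemma supp_le_iff {A B : H →ₗ[ℂ] H} {e : OrthonormalBasis ι ℂ H} {α : ι → ℝ}
    {f : OrthonormalBasis κ ℂ H} {β : κ → ℝ} (hA : Diag A e α) (hB : Diag B f β) :
    supp A ≤ supp B ↔ ∀ i j, α i ≠ 0 → β j = 0 → inner ℂ (e i) (f j) = 0 := by
  rw [supp, supp, Submodule.orthogonal_le_orthogonal_iff]
  constructor
  · intro h i j hi hj
    have h1 : A (f j) = 0 := h (by simp [hB.apply, hj])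
    have h2 := hA.inner_apply i (f j)
    rw [h1, inner_zero_right] at h2
    simpa [hi] using h2.symm
  · intro h x hx
    rw [LinearMap.mem_ker] at hx ⊢
    rw [← e.sum_repr' (A x)]
    refine Finset.sum_eq_zero fun i _ => ?_
    rw [hA.inner_apply]
    by_cases hi : α i = 0
    · simp [hi]
    rw [← f.sum_inner_mul_inner (e i) x, Finset.sum_eq_zero, mul_zero, zero_smul]
    intro j _
    by_cases hj : β j = 0
    · rw [h i j hi hj, zero_mul]
    · have h2 := hB.inner_apply j x
      rw [hx, inner_zero_right] at h2
      rcases mul_eq_zero.1 h2.symm with h3 | h3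
      · exact absurd (by exact_mod_cast h3) hj
      · rw [h3, mul_zero]

end EigenbasisFormula

/-! ### Slope at infinity and the divergence for arbitrary supports -/

section DivergenceFormula

section Convex

variable {f : ℝ → ℝ}

lemma secant_lt (hf : StrictConvexOn ℝ (Set.Ici 0) f) {x y : ℝ} (hx : 0 < x) (hxy : x < y) :
    (f x - f 0) / x < (f y - f 0) / y := by
  simpa using hf.secant_strict_mono (a := 0) (by simp) (Set.mem_Ici.2 hx.le)
    (Set.mem_Ici.2 (hx.trans hxy).le) hx.ne' (hx.trans hxy).ne' hxy

lemma exists_slope_limit (hf : StrictConvexOn ℝ (Set.Ici 0) f) :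
    (∃ ω, Tendsto (fun x => f x / x) atTop (𝓝 ω)) ∨ Tendsto (fun x => f x / x) atTop atTop := by
  -- Secant slopes from `0` increase on `(0, ∞)`; the cutoff `max x 1` turns this into monotonicity
  -- on all of `ℝ` without affecting the limit.
  have hmono : Monotone fun x : ℝ => (f (max x 1) - f 0) / max x 1 := by
    intro x y hxy
    rcases (max_le_max_right 1 hxy).eq_or_lt with h | h
    · simp only [h, le_refl]
    · exact (secant_lt hf (by positivity) h).le
  have hev : ∀ᶠ x : ℝ in atTop, (f (max x 1) - f 0) / max x 1 + f 0 / x = f x / x := by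
    filter_upwards [eventually_ge_atTop 1] with x hx
    rw [max_eq_left hx, ← add_div, sub_add_cancel]
  have h0 : Tendsto (fun x : ℝ => f 0 / x) atTop (𝓝 0) := tendsto_const_nhds.div_atTop tendsto_id
  rcases tendsto_atTop_of_monotone hmono with h | ⟨l, h⟩
  · exact Or.inr ((h.atTop_add h0).congr' hev)
  · exact Or.inl ⟨l + 0, (h.add h0).congr' hev⟩

lemma lt_add_slope_mul (hf : StrictConvexOn ℝ (Set.Ici 0) f) {ω : ℝ}
    (hω : Tendsto (fun x => f x / x) atTop (𝓝 ω)) {c x : ℝ} (hc : 0 ≤ c) (hx : c < x) :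
    f x < f c + ω * (x - c) := by
  have hcx : ∀ {y z}, c < y → y < z → (f y - f c) / (y - c) < (f z - f c) / (z - c) :=
    fun {y z} hy hz => hf.secant_strict_mono (Set.mem_Ici.2 hc) (Set.mem_Ici.2 (hc.trans hy.le))
      (Set.mem_Ici.2 (hc.trans (hy.trans hz).le)) hy.ne' (hy.trans hz).ne' hz
  -- The limit only bounds secant slopes weakly by `ω`; passing through the intermediate point `x +
  -- 1` restores strictness.
  set s := (f (x + 1) - f c) / (x + 1 - c) with hs
  have hsω : s ≤ ω := by
    have h1 : Tendsto (fun y : ℝ => s + (f c - s * c) / y) atTop (𝓝 (s + 0)) :=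
      tendsto_const_nhds.add (tendsto_const_nhds.div_atTop tendsto_id)
    rw [add_zero] at h1
    refine le_of_tendsto_of_tendsto h1 hω ?_
    filter_upwards [eventually_gt_atTop (x + 1)] with y hy
    have hy0 : 0 < y := by linarith
    have h2 := hcx (by linarith) hy
    rw [← hs, lt_div_iff₀ (by linarith)] at h2
    rw [le_div_iff₀ hy0, add_mul, div_mul_cancel₀ _ hy0.ne']
    linarith
  have h3 := hcx hx (lt_add_one x)
  rw [← hs, div_lt_iff₀ (by linarith)] at h3
  nlinarith [mul_le_mul_of_nonneg_right hsω (sub_nonneg.2 hx.le)]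

/-- The perspective function of `f`, with slope `ω` at infinity. -/
def pers (f : ℝ → ℝ) (ω a b : ℝ) : ℝ := if b = 0 then a * ω else b * f (a / b)

@[simp] lemma pers_zero_right (ω a : ℝ) : pers f ω a 0 = a * ω := if_pos rfl

lemma pers_of_ne (ω a : ℝ) {b : ℝ} (hb : b ≠ 0) : pers f ω a b = b * f (a / b) := if_neg hb

@[simp] lemma pers_zero_left (ω b : ℝ) : pers f ω 0 b = f 0 * b := by
  by_cases hb : b = 0
  · simp [hb]
  · rw [pers_of_ne _ _ hb, zero_div, mul_comm]

lemma tendsto_pers_of_ne (hf : StrictConvexOn ℝ (Set.Ici 0) f) (ω : ℝ) {a b : ℝ} (ha : 0 ≤ a)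
    (hb : 0 ≤ b) (hab : b ≠ 0 ∨ a = 0) :
    Tendsto (fun ε : ℝ => (b + ε) * f (a / (b + ε))) (𝓝[>] 0) (𝓝 (pers f ω a b)) := by
  have hadd : Tendsto (fun ε : ℝ => b + ε) (𝓝[>] 0) (𝓝 b) := by
    have : Tendsto (fun ε : ℝ => b + ε) (𝓝 0) (𝓝 (b + 0)) :=
      tendsto_const_nhds.add tendsto_id
    rw [add_zero] at this
    exact this.mono_left nhdsWithin_le_nhds
  -- A convex `f` may jump at `0`. For `a = 0` the argument of `f` stays at `0`, so continuity is
  -- needed only in the interior.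
  rcases ha.eq_or_lt with rfl | ha
  · simp only [zero_div, pers_zero_left]
    rw [mul_comm]
    exact hadd.mul_const _
  · have hb0 : b ≠ 0 := hab.resolve_right ha.ne'
    have hb' : 0 < b := hb.lt_of_ne' hb0
    rw [pers_of_ne _ _ hb0]
    have hc : ContinuousAt f (a / b) := by
      have h1 := hf.convexOn.continuousOn_interior
      rw [interior_Ici] at h1
      exact h1.continuousAt (Ioi_mem_nhds (div_pos ha hb'))
    exact hadd.mul (hc.tendsto.comp (tendsto_const_nhds.div hadd hb0))

lemma tendsto_const_div_nhdsGT {a : ℝ} (ha : 0 < a) :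
    Tendsto (fun ε : ℝ => a / ε) (𝓝[>] 0) atTop := by
  simpa only [div_eq_mul_inv] using tendsto_inv_nhdsGT_zero.const_mul_atTop ha

lemma eventually_mul_slope_eq {a : ℝ} (ha : 0 < a) :
    ∀ᶠ ε : ℝ in 𝓝[>] 0, a * (f (a / ε) / (a / ε)) = (0 + ε) * f (a / (0 + ε)) := by
  filter_upwards [self_mem_nhdsWithin] with ε hε
  have hε' : ε ≠ 0 := (Set.mem_Ioi.1 hε).ne'
  rw [zero_add]
  field_simp

lemma tendsto_pers (hf : StrictConvexOn ℝ (Set.Ici 0) f) {ω : ℝ}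
    (hω : Tendsto (fun x => f x / x) atTop (𝓝 ω)) {a b : ℝ} (ha : 0 ≤ a) (hb : 0 ≤ b) :
    Tendsto (fun ε : ℝ => (b + ε) * f (a / (b + ε))) (𝓝[>] 0) (𝓝 (pers f ω a b)) := by
  by_cases hab : b ≠ 0 ∨ a = 0
  · exact tendsto_pers_of_ne hf ω ha hb hab
  · push Not at hab
    obtain ⟨rfl, ha0⟩ := hab
    have ha' : 0 < a := ha.lt_of_ne' ha0
    rw [pers_zero_right]
    exact ((hω.comp (tendsto_const_div_nhdsGT ha')).const_mul a).congr' (eventually_mul_slope_eq ha')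

lemma tendsto_pers_atTop (hω : Tendsto (fun x => f x / x) atTop atTop) {a b : ℝ} (ha : 0 < a)
    (hb : b = 0) : Tendsto (fun ε : ℝ => (b + ε) * f (a / (b + ε))) (𝓝[>] 0) atTop := by
  subst hb
  exact ((hω.comp (tendsto_const_div_nhdsGT ha)).const_mul_atTop ha).congr'
    (eventually_mul_slope_eq ha)

lemma tendsto_sum_atTop {ι X : Type*} {l : Filter X} {s : Finset ι} {t : ι → X → ℝ}
    (h : ∀ i ∈ s, ∃ c, ∀ᶠ x in l, c ≤ t i x) {i₀ : ι} (hi₀ : i₀ ∈ s)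
    (ht : Tendsto (t i₀) l atTop) : Tendsto (fun x => ∑ i ∈ s, t i x) l atTop := by
  classical
  choose! c hc using h
  have h1 : ∀ᶠ x in l, ∀ i ∈ s, c i ≤ t i x := (Finset.eventually_all s).2 hc
  have h2 : Tendsto (fun x => (∑ i ∈ s.erase i₀, c i) + t i₀ x) l atTop :=
    tendsto_atTop_add_const_left _ _ ht
  refine tendsto_atTop_mono' l ?_ h2
  filter_upwards [h1] with x hx
  rw [← Finset.sum_erase_add _ _ hi₀]
  gcongr with i hi
  exact hx i (Finset.mem_of_mem_erase hi)

end Convex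

variable {H : Type*} [NormedAddCommGroup H] [InnerProductSpace ℂ H] [FiniteDimensional ℂ H]
variable {ι κ : Type*} [Fintype ι] [Fintype κ]

/-- Here `ω` is arbitrary: a term with `β j = 0` has either `α i = 0` or zero weight. -/
lemma fDiv_of_supp_le {f : ℝ → ℝ} (ω : ℝ) {A B : H →ₗ[ℂ] H} {e : OrthonormalBasis ι ℂ H}
    {α : ι → ℝ} {g : OrthonormalBasis κ ℂ H} {β : κ → ℝ} (hA : Diag A e α) (hB : Diag B g β)
    (hs : supp A ≤ supp B) :
    fDiv f A B = ((∑ i, ∑ j, pers f ω (α i) (β j) * ‖inner ℂ (e i) (g j)‖ ^ 2 : ℝ) : EReal) := by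
  rw [fDiv, if_pos hs, quasiEntropy_eq f hA hB]
  congr 1
  refine Finset.sum_congr rfl fun i _ => Finset.sum_congr rfl fun j _ => ?_
  by_cases hj : β j = 0
  · by_cases hi : α i = 0
    · simp [hi, hj]
    · simp [(supp_le_iff hA hB).1 hs i j hi hj]
  · rw [pers_of_ne _ _ hj]

lemma eventually_quasiEntropy_eq (f : ℝ → ℝ) {A B : H →ₗ[ℂ] H} {e : OrthonormalBasis ι ℂ H}
    {α : ι → ℝ} {g : OrthonormalBasis κ ℂ H} {β : κ → ℝ} (hA : Diag A e α) (hB : Diag B g β) :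
    ∀ᶠ ε : ℝ in 𝓝[>] 0, ∑ i, ∑ j, (β j + ε) * f (α i / (β j + ε)) * ‖inner ℂ (e i) (g j)‖ ^ 2 =
      quasiEntropy f A (B + (ε : ℂ) • (1 : H →ₗ[ℂ] H)) := by
  filter_upwards [self_mem_nhdsWithin] with ε hε
  rw [quasiEntropy_eq f hA (hB.add_smul_one (le_of_lt hε))]

lemma fDiv_of_tendsto {f : ℝ → ℝ} (hf : StrictConvexOn ℝ (Set.Ici 0) f) {ω : ℝ}
    (hω : Tendsto (fun x => f x / x) atTop (𝓝 ω)) {A B : H →ₗ[ℂ] H} {e : OrthonormalBasis ι ℂ H}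
    {α : ι → ℝ} {g : OrthonormalBasis κ ℂ H} {β : κ → ℝ} (hA : Diag A e α) (hB : Diag B g β) :
    fDiv f A B = ((∑ i, ∑ j, pers f ω (α i) (β j) * ‖inner ℂ (e i) (g j)‖ ^ 2 : ℝ) : EReal) := by
  by_cases hs : supp A ≤ supp B
  · exact fDiv_of_supp_le ω hA hB hs
  · rw [fDiv, if_neg hs]
    refine Tendsto.limUnder_eq ((continuous_coe_real_ereal.tendsto _).comp ?_)
    refine Tendsto.congr' (eventually_quasiEntropy_eq f hA hB) ?_
    exact tendsto_finsetSum _ fun i _ => tendsto_finsetSum _ fun j _ =>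
      (tendsto_pers hf hω (hA.nonneg i) (hB.nonneg j)).mul_const _

lemma fDiv_of_tendsto_atTop {f : ℝ → ℝ} (hf : StrictConvexOn ℝ (Set.Ici 0) f)
    (hω : Tendsto (fun x => f x / x) atTop atTop) {A B : H →ₗ[ℂ] H} {e : OrthonormalBasis ι ℂ H}
    {α : ι → ℝ} {g : OrthonormalBasis κ ℂ H} {β : κ → ℝ} (hA : Diag A e α) (hB : Diag B g β)
    (hs : ¬ supp A ≤ supp B) : fDiv f A B = ⊤ := by
  rw [fDiv, if_neg hs]
  refine Tendsto.limUnder_eq (EReal.tendsto_coe_nhds_top_iff.2 ?_)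
  refine Tendsto.congr' (eventually_quasiEntropy_eq f hA hB) ?_
  simp only [← Fintype.sum_prod_type']
  rw [supp_le_iff hA hB] at hs
  push Not at hs
  obtain ⟨i, j, hi, hj, hij⟩ := hs
  -- The pair `(i, j)` violating the inclusion of supports contributes a term tending to `+∞`; every
  -- other term either converges or is eventually nonnegative.
  refine tendsto_sum_atTop (fun p _ => ?_) (Finset.mem_univ (i, j)) ?_
  · by_cases hp : β p.2 ≠ 0 ∨ α p.1 = 0
    · exact ⟨_, ((tendsto_pers_of_ne hf 0 (hA.nonneg p.1) (hB.nonneg p.2) hp).mul_const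
        (‖inner ℂ (e p.1) (g p.2)‖ ^ 2)).eventually (eventually_ge_nhds (sub_one_lt _))⟩
    · push Not at hp
      refine ⟨0, ?_⟩
      have h1 := tendsto_pers_atTop hω ((hA.nonneg p.1).lt_of_ne' hp.2) hp.1
      filter_upwards [h1.eventually_ge_atTop 0] with ε hε
      positivity
  · have h1 := tendsto_pers_atTop hω ((hA.nonneg i).lt_of_ne' hi) hj
    exact h1.atTop_mul_const (by positivity)

end DivergenceFormula

/-! ### Special values of the divergence and what they detect -/

section DivergenceValues

section Convex

variable {f : ℝ → ℝ}

lemma pers_le (hf : StrictConvexOn ℝ (Set.Ici 0) f) {ω : ℝ}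
    (hω : Tendsto (fun x => f x / x) atTop (𝓝 ω)) {a b : ℝ} (ha : 0 ≤ a) (hb : 0 ≤ b) :
    pers f ω a b ≤ ω * a + f 0 * b := by
  rcases hb.eq_or_lt with rfl | hb
  · simp [mul_comm]
  rcases ha.eq_or_lt with rfl | ha
  · simp
  have h := lt_add_slope_mul hf hω le_rfl (div_pos ha hb)
  rw [pers_of_ne _ _ hb.ne']
  calc b * f (a / b) ≤ b * (f 0 + ω * (a / b - 0)) := by gcongr
    _ = ω * a + f 0 * b := by field_simp; ring

lemma pers_le_of_le (hf : StrictConvexOn ℝ (Set.Ici 0) f) (ω : ℝ) {a b : ℝ} (ha : 0 ≤ a)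
    (hb : 0 < b) (hab : a ≤ b) : pers f ω a b ≤ (f 1 - f 0) * a + f 0 * b := by
  have hab' : a / b ≤ 1 := (div_le_one hb).2 hab
  have h := hf.convexOn.2 (x := 0) (y := 1) (by simp) (by simp) (sub_nonneg.2 hab')
    (div_nonneg ha hb.le) (by ring)
  simp only [smul_eq_mul, mul_zero, mul_one, zero_add] at h
  rw [pers_of_ne _ _ hb.ne']
  calc b * f (a / b) ≤ b * ((1 - a / b) * f 0 + a / b * f 1) := by gcongr
    _ = (f 1 - f 0) * a + f 0 * b := by field_simp; ring

lemma lt_pers_one (hf : StrictConvexOn ℝ (Set.Ici 0) f) {ω b : ℝ} (hb : 0 < b) (hb1 : b < 1) :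
    f 1 - f 0 < pers f ω 1 b - f 0 * b := by
  have h := secant_lt hf one_pos ((one_lt_div hb).2 hb1)
  rw [pers_of_ne _ _ hb.ne']
  rw [div_one, one_div, div_inv_eq_mul] at h
  rw [one_div]
  linarith

/-- The slope over `[a/2, b/2]` is below the slope over `[a/2, b]`, which is at most the slope over
`[a, b]`; the first interval has half the length of the last. -/
lemma persp_diff_strictAnti (hf : StrictConvexOn ℝ (Set.Ici 0) f) {a b : ℝ} (ha : 0 ≤ a)
    (hab : a < b) : 2 * f (b / 2) - f b < 2 * f (a / 2) - f a := by
  have hb : 0 < b := ha.trans_lt hab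
  have h1 := hf.secant_strict_mono (a := a / 2) (x := b / 2) (y := b) (Set.mem_Ici.2 (by linarith))
    (Set.mem_Ici.2 (by linarith)) (Set.mem_Ici.2 hb.le) (by linarith) (by linarith) (by linarith)
  have h2 := hf.convexOn.secant_mono (a := b) (x := a / 2) (y := a) (Set.mem_Ici.2 hb.le)
    (Set.mem_Ici.2 (by linarith)) (Set.mem_Ici.2 ha) (by linarith) (by linarith) (by linarith)
  have h3 : (f (a / 2) - f b) / (a / 2 - b) = (f b - f (a / 2)) / (b - a / 2) := by
    rw [← neg_sub, ← neg_sub b, neg_div_neg_eq]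
  have h4 : (f a - f b) / (a - b) = (f b - f a) / (b - a) := by
    rw [← neg_sub, ← neg_sub b, neg_div_neg_eq]
  rw [h3, h4] at h2
  have h5 := h1.trans_le h2
  have h6 : (f (b / 2) - f (a / 2)) / (b / 2 - a / 2) =
      2 * (f (b / 2) - f (a / 2)) / (b - a) := by
    rw [← sub_div, div_div_eq_mul_div, mul_comm]
  rw [h6, div_lt_div_iff_of_pos_right (by linarith)] at h5
  linarith

/-- The excesses `β i - 1` are nonnegative with sum `1`, so each `β i` lies in `[1, 2]`, where `f`
is below its chord. Summing the chord bounds gives exactly the assumed lower bound, so equality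
holds throughout and strict convexity forces every `β i` to be `1` or `2`. -/
lemma exists_eq_one_add_single (hf : StrictConvexOn ℝ (Set.Ici 0) f) {ι : Type*} [Fintype ι]
    [DecidableEq ι] {β : ι → ℝ} (hβ : ∀ i, 1 ≤ β i) (hsum : ∑ i, β i = Fintype.card ι + 1)
    (h : (Fintype.card ι - 1) * f 1 + f 2 ≤ ∑ i, f (β i)) :
    ∃ j, β = fun i => 1 + (Pi.single j 1 : ι → ℝ) i := by
  have hsum' : ∑ i, (β i - 1) = 1 := by simp [hsum]
  have hle : ∀ i, β i - 1 ≤ 1 := fun i => by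
    refine le_of_le_of_eq ?_ hsum'
    exact Finset.single_le_sum (f := fun i => β i - 1) (fun i _ => sub_nonneg.2 (hβ i))
      (Finset.mem_univ i)
  have hc : ∀ i, f (β i) ≤ (2 - β i) * f 1 + (β i - 1) * f 2 := fun i => by
    have : f ((2 - β i) • 1 + (β i - 1) • 2) ≤ (2 - β i) • f 1 + (β i - 1) • f 2 :=
      hf.convexOn.2 (by simp) (by simp) (by linarith [hle i]) (by linarith [hβ i]) (by ring)
    simp only [smul_eq_mul] at this
    convert this using 2
    ring
  have htot : ∑ i, ((2 - β i) * f 1 + (β i - 1) * f 2) = (Fintype.card ι - 1) * f 1 + f 2 := by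
    rw [Finset.sum_add_distrib, ← Finset.sum_mul, ← Finset.sum_mul, hsum', one_mul,
      Finset.sum_sub_distrib, hsum]
    simp only [Finset.sum_const, Finset.card_univ, nsmul_eq_mul]
    ring
  have heq : ∀ i, β i - 1 = 0 ∨ β i - 1 = 1 := by
    intro i
    by_contra hcon
    push Not at hcon
    have hlt : f (β i) < (2 - β i) * f 1 + (β i - 1) * f 2 := by
      have : f ((2 - β i) • 1 + (β i - 1) • 2) < (2 - β i) • f 1 + (β i - 1) • f 2 :=
        hf.2 (by simp) (by simp) (by norm_num) (by linarith [lt_of_le_of_ne (hle i) hcon.2])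
          (lt_of_le_of_ne (sub_nonneg.2 (hβ i)) hcon.1.symm) (by ring)
      simp only [smul_eq_mul] at this
      convert this using 2
      ring
    have := Finset.sum_lt_sum (fun i _ => hc i) ⟨i, Finset.mem_univ i, hlt⟩
    linarith
  obtain ⟨j, hj⟩ : ∃ j, β j - 1 ≠ 0 := by
    by_contra hcon
    push Not at hcon
    simp [hcon] at hsum'
  have hj1 := (heq j).resolve_left hj
  refine ⟨j, funext fun i => ?_⟩
  rcases eq_or_ne i j with rfl | hij
  · rw [Pi.single_eq_same]
    linarith
  · rw [Pi.single_eq_of_ne hij]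
    have h1 : ∑ k ∈ Finset.univ.erase j, (β k - 1) = 0 := by
      rw [Finset.sum_erase_eq_sub (Finset.mem_univ j), hsum', hj1, sub_self]
    have h2 := (Finset.sum_eq_zero_iff_of_nonneg fun k _ => sub_nonneg.2 (hβ k)).1 h1 i
      (Finset.mem_erase.2 ⟨hij, Finset.mem_univ i⟩)
    linarith

end Convex

section Sums

variable {H : Type*} [NormedAddCommGroup H] [InnerProductSpace ℂ H]
variable {ι κ : Type*} [Fintype ι] [Fintype κ]

lemma sum_affine_weight (e : OrthonormalBasis ι ℂ H) (g : OrthonormalBasis κ ℂ H) (u v : ℝ)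
    (α : ι → ℝ) (β : κ → ℝ) :
    ∑ i, ∑ j, (u * α i + v * β j) * ‖inner ℂ (e i) (g j)‖ ^ 2 =
      u * ∑ i, α i + v * ∑ j, β j := by
  simp only [add_mul, Finset.sum_add_distrib]
  congr 1
  · simp only [← Finset.mul_sum, sum_weight_right, mul_one]
  · rw [Finset.sum_comm]
    simp only [← Finset.mul_sum, sum_weight_left, mul_one]

lemma sum_diagonal_weight (g : OrthonormalBasis ι ℂ H) (F : ι → ι → ℝ) :
    ∑ i, ∑ j, F i j * ‖inner ℂ (g i) (g j)‖ ^ 2 = ∑ i, F i i := by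
  classical
  refine Finset.sum_congr rfl fun i _ => ?_
  rw [Finset.sum_eq_single i]
  · simp
  · intro j _ hj
    simp [g.inner_eq_zero hj.symm]
  · simp

/-- The operator with eigenbasis `g` and eigenvalues `α`. -/
def diagOp (g : OrthonormalBasis ι ℂ H) (α : ι → ℝ) : H →ₗ[ℂ] H :=
  g.toBasis.constr ℂ fun i => (α i : ℂ) • g i

lemma diag_diagOp (g : OrthonormalBasis ι ℂ H) {α : ι → ℝ} (hα : ∀ i, 0 ≤ α i) :
    Diag (diagOp g α) g α :=
  ⟨hα, fun i => by
    have := g.toBasis.constr_basis ℂ (fun i => (α i : ℂ) • g i) i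
    rwa [g.coe_toBasis] at this⟩

lemma rtr_smul (c : ℝ) (A : H →ₗ[ℂ] H) : rtr ((c : ℂ) • A) = c * rtr A := by
  simp [rtr]

lemma supp_smul_le {A : H →ₗ[ℂ] H} (c : ℂ) : supp (c • A) ≤ supp A := by
  refine Submodule.orthogonal_le fun x hx => ?_
  rw [LinearMap.mem_ker] at hx ⊢
  rw [LinearMap.smul_apply, hx, smul_zero]

lemma supp_le_one (A : H →ₗ[ℂ] H) : supp A ≤ supp (1 : H →ₗ[ℂ] H) := by
  have : LinearMap.ker (1 : H →ₗ[ℂ] H) = ⊥ := LinearMap.ker_id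
  simp [supp, this]

lemma diag_one_add_ketbra [DecidableEq κ] (g : OrthonormalBasis κ ℂ H) (j : κ) :
    Diag (1 + ketbra (g j) (g j)) g (fun k => 1 + (Pi.single j 1 : κ → ℝ) k) := by
  refine ⟨fun k => ?_, fun k => ?_⟩
  · by_cases hk : k = j
    · subst hk; simp
    · simp [hk]
  · rw [LinearMap.add_apply, Module.End.one_apply, ketbra_apply, g.inner_eq_ite]
    by_cases hk : k = j
    · subst hk; simp [add_smul]
    · simp [hk, Ne.symm hk]

end Sums

variable {H : Type*} [NormedAddCommGroup H] [InnerProductSpace ℂ H] [FiniteDimensional ℂ H]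
variable {ι κ : Type*} [Fintype ι] [Fintype κ] {f : ℝ → ℝ}

lemma rtr_nonneg {A : H →ₗ[ℂ] H} (hA : A.IsPositive) : 0 ≤ rtr A := by
  obtain ⟨e, α, h⟩ := exists_diag hA
  rw [h.rtr_eq]
  exact Finset.sum_nonneg fun i _ => h.nonneg i

lemma rtr_eq_zero_iff {A : H →ₗ[ℂ] H} (hA : A.IsPositive) : rtr A = 0 ↔ A = 0 := by
  refine ⟨fun h0 => ?_, fun h0 => by simp [rtr, h0]⟩
  obtain ⟨e, α, h⟩ := exists_diag hA
  rw [h.rtr_eq, Finset.sum_eq_zero_iff_of_nonneg fun i _ => h.nonneg i] at h0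
  refine e.toBasis.ext fun i => ?_
  simp [h.apply, h0 i (Finset.mem_univ i)]

lemma supp_le_zero {A : H →ₗ[ℂ] H} (h : supp A ≤ supp (0 : H →ₗ[ℂ] H)) : A = 0 := by
  rw [supp, supp, Submodule.orthogonal_le_orthogonal_iff, LinearMap.ker_zero, top_le_iff,
    LinearMap.ker_eq_top] at h
  exact h

lemma fDiv_zero_left {B : H →ₗ[ℂ] H} (hB : B.IsPositive) :
    fDiv f 0 B = ((f 0 * rtr B : ℝ) : EReal) := by
  obtain ⟨g, β, h⟩ := exists_diag hB
  have hs : supp (0 : H →ₗ[ℂ] H) ≤ supp B := by simp [supp]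
  rw [fDiv_of_supp_le 0 (diag_zero g) h hs, h.rtr_eq]
  congr 1
  simpa using sum_affine_weight g g 0 (f 0) (fun _ => 0) β

lemma fDiv_smul_self {B : H →ₗ[ℂ] H} (hB : B.IsPositive) {c : ℝ} (hc : 0 ≤ c) :
    fDiv f ((c : ℂ) • B) B = ((f c * rtr B : ℝ) : EReal) := by
  obtain ⟨g, β, h⟩ := exists_diag hB
  rw [fDiv_of_supp_le 0 (h.smul hc) h (supp_smul_le _), h.rtr_eq, sum_diagonal_weight,
    Finset.mul_sum]
  congr 1
  refine Finset.sum_congr rfl fun i _ => ?_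
  by_cases hi : β i = 0
  · simp [hi]
  · rw [pers_of_ne _ _ hi, mul_div_cancel_right₀ _ hi, mul_comm]

lemma fDiv_self {B : H →ₗ[ℂ] H} (hB : B.IsPositive) : fDiv f B B = ((f 1 * rtr B : ℝ) : EReal) := by
  simpa using fDiv_smul_self (f := f) hB zero_le_one

lemma fDiv_zero_right (hf : StrictConvexOn ℝ (Set.Ici 0) f) {ω : ℝ}
    (hω : Tendsto (fun x => f x / x) atTop (𝓝 ω)) {A : H →ₗ[ℂ] H} (hA : A.IsPositive) :
    fDiv f A 0 = ((ω * rtr A : ℝ) : EReal) := by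
  obtain ⟨e, α, h⟩ := exists_diag hA
  rw [fDiv_of_tendsto hf hω h (diag_zero e), h.rtr_eq, sum_diagonal_weight, Finset.mul_sum]
  simp [mul_comm]

lemma fDiv_le (hf : StrictConvexOn ℝ (Set.Ici 0) f) {ω : ℝ}
    (hω : Tendsto (fun x => f x / x) atTop (𝓝 ω)) {A B : H →ₗ[ℂ] H} (hA : A.IsPositive)
    (hB : B.IsPositive) : fDiv f A B ≤ ((ω * rtr A + f 0 * rtr B : ℝ) : EReal) := by
  obtain ⟨e, α, h⟩ := exists_diag hA
  obtain ⟨g, β, h'⟩ := exists_diag hB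
  rw [fDiv_of_tendsto hf hω h h', h.rtr_eq, h'.rtr_eq, EReal.coe_le_coe_iff,
    ← sum_affine_weight e g]
  gcongr with i _ j _
  exact pers_le hf hω (h.nonneg i) (h'.nonneg j)

lemma exists_fDiv_eq_coe (hf : StrictConvexOn ℝ (Set.Ici 0) f) {ω : ℝ}
    (hω : Tendsto (fun x => f x / x) atTop (𝓝 ω)) {A B : H →ₗ[ℂ] H} (hA : A.IsPositive)
    (hB : B.IsPositive) : ∃ r : ℝ, fDiv f A B = r := by
  obtain ⟨e, α, h⟩ := exists_diag hA
  obtain ⟨g, β, h'⟩ := exists_diag hB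
  exact ⟨_, fDiv_of_tendsto hf hω h h'⟩

lemma le_fDiv (hf : StrictConvexOn ℝ (Set.Ici 0) f)
    (hω : Tendsto (fun x => f x / x) atTop atTop) {m : ℝ} (hm : ∀ x, 0 ≤ x → m ≤ f x)
    {A B : H →ₗ[ℂ] H} (hA : A.IsPositive) (hB : B.IsPositive) :
    ((m * rtr B : ℝ) : EReal) ≤ fDiv f A B := by
  obtain ⟨e, α, h⟩ := exists_diag hA
  obtain ⟨g, β, h'⟩ := exists_diag hB
  by_cases hs : supp A ≤ supp B
  · have h1 := sum_affine_weight e g 0 m α β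
    simp only [zero_mul, zero_add] at h1
    rw [fDiv_of_supp_le 0 h h' hs, EReal.coe_le_coe_iff, h'.rtr_eq, ← h1]
    gcongr with i _ j _
    by_cases hj : β j = 0
    · simp [hj]
    · rw [pers_of_ne _ _ hj, mul_comm]
      exact mul_le_mul_of_nonneg_left (hm _ (div_nonneg (h.nonneg i) (h'.nonneg j))) (h'.nonneg j)
  · rw [fDiv_of_tendsto_atTop hf hω h h' hs]
    exact le_top

/-- If every `β j ≥ 1`, then trace one gives `α i ≤ 1 ≤ β j`, and the chord of `f` over `[0, 1]`
bounds each perspective. If some `β j < 1`, the projection onto `g j` breaks the bound, since the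
secant slope from `0` at `1 / β j` (or at infinity) exceeds the one at `1`. -/
lemma one_le_eigenvalues_iff (hf : StrictConvexOn ℝ (Set.Ici 0) f) {B : H →ₗ[ℂ] H}
    {g : OrthonormalBasis κ ℂ H} {β : κ → ℝ} (hB : Diag B g β) :
    (∀ A : H →ₗ[ℂ] H, A.IsPositive → rtr A = 1 →
      fDiv f A B ≤ ((f 1 - f 0 + f 0 * rtr B : ℝ) : EReal)) ↔ ∀ j, 1 ≤ β j := by
  classical
  constructor
  · intro h j
    by_contra! hj
    have hα : ∀ i, 0 ≤ (Pi.single j 1 : κ → ℝ) i := fun i => by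
      by_cases hi : i = j
      · subst hi; simp
      · simp [hi]
    have hA := diag_diagOp g hα
    have h1 := h _ hA.isPositive (by rw [hA.rtr_eq]; simp)
    have hsum : ∀ ω, ∑ i, ∑ k, pers f ω ((Pi.single j 1 : κ → ℝ) i) (β k) *
        ‖inner ℂ (g i) (g k)‖ ^ 2 = pers f ω 1 (β j) - f 0 * β j + f 0 * rtr B := by
      intro ω
      rw [sum_diagonal_weight, hB.rtr_eq, ← Finset.add_sum_erase _ _ (Finset.mem_univ j),
        ← Finset.add_sum_erase _ β (Finset.mem_univ j), Pi.single_eq_same, mul_add, Finset.mul_sum]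
      rw [Finset.sum_congr rfl fun i hi => by
        rw [Pi.single_eq_of_ne (Finset.ne_of_mem_erase hi), pers_zero_left]]
      ring
    by_cases hj0 : β j = 0
    · rcases exists_slope_limit hf with ⟨ω, hω⟩ | hω
      · rw [fDiv_of_tendsto hf hω hA hB, hsum, EReal.coe_le_coe_iff, hj0] at h1
        have h2 := lt_add_slope_mul hf hω le_rfl one_pos
        simp at h1 h2
        linarith
      · rw [fDiv_of_tendsto_atTop hf hω hA hB, top_le_iff] at h1
        · exact EReal.coe_ne_top _ h1
        · rw [supp_le_iff hA hB]
          intro hs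
          simpa using hs j j (by simp) hj0
    · have hs : supp (diagOp g (Pi.single j 1)) ≤ supp B := by
        rw [supp_le_iff hA hB]
        intro i k hi hk
        have hij : i = j := by
          by_contra hij
          exact hi (Pi.single_eq_of_ne hij _)
        subst hij
        exact g.inner_eq_zero (by rintro rfl; exact hj0 hk)
      rw [fDiv_of_supp_le 0 hA hB hs, hsum, EReal.coe_le_coe_iff] at h1
      have h2 := lt_pers_one hf (ω := 0) ((hB.nonneg j).lt_of_ne' hj0) hj
      linarith
  · intro h A hA htr
    obtain ⟨e, α, h'⟩ := exists_diag hA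
    rw [h'.rtr_eq] at htr
    have hs : supp A ≤ supp B := by
      rw [supp_le_iff h' hB]
      intro i j _ hj
      linarith [h j]
    have h1 := sum_affine_weight e g (f 1 - f 0) (f 0) α β
    rw [htr, mul_one] at h1
    rw [fDiv_of_supp_le 0 h' hB hs, EReal.coe_le_coe_iff, hB.rtr_eq, ← h1]
    gcongr with i _ j _
    refine pers_le_of_le hf 0 (h'.nonneg i) (by linarith [h j]) (le_trans ?_ (h j))
    rw [← htr]
    exact Finset.single_le_sum (fun i _ => h'.nonneg i) (Finset.mem_univ i)

lemma fDiv_one_right {A : H →ₗ[ℂ] H} {e : OrthonormalBasis ι ℂ H} {α : ι → ℝ} (hA : Diag A e α) :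
    fDiv f A 1 = ((∑ i, f (α i) : ℝ) : EReal) := by
  rw [fDiv_of_supp_le 0 hA (diag_one e) (supp_le_one A), sum_diagonal_weight]
  simp [pers]

/-- The difference of two perspective functions of `f`. -/
def perspDiff (f : ℝ → ℝ) (a : ℝ) : ℝ := 2 * f (a / 2) - f a

lemma perspDiff_injOn (hf : StrictConvexOn ℝ (Set.Ici 0) f) :
    Set.InjOn (perspDiff f) (Set.Ici 0) :=
  StrictAntiOn.injOn fun _ ha _ _ hab => persp_diff_strictAnti hf ha hab

lemma exists_basis_apply_eq {y : H} (hy : ‖y‖ = 1) :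
    ∃ (g : OrthonormalBasis (Fin (Module.finrank ℂ H)) ℂ H) (j : _), g j = y := by
  have hy0 : y ≠ 0 := by
    rintro rfl
    simp at hy
  have : Nontrivial H := ⟨y, 0, hy0⟩
  let j : Fin (Module.finrank ℂ H) := ⟨0, Module.finrank_pos⟩
  obtain ⟨g, hg⟩ := Orthonormal.exists_orthonormalBasis_extension_of_card_eq (𝕜 := ℂ)
    (ι := Fin (Module.finrank ℂ H)) (by simp) (v := fun _ => y) (s := {j}) (by
      refine ⟨fun i => by simpa using hy, fun i k hik => ?_⟩
      exact absurd (Subsingleton.elim i k) hik)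
  exact ⟨g, j, hg j rfl⟩

lemma isPositive_one_add_ketbra {y : H} (hy : ‖y‖ = 1) : (1 + ketbra y y).IsPositive := by
  obtain ⟨g, j, rfl⟩ := exists_basis_apply_eq hy
  exact (diag_one_add_ketbra g j).isPositive

lemma inner_opFun_apply {A : H →ₗ[ℂ] H} {e : OrthonormalBasis ι ℂ H} {α : ι → ℝ}
    (hA : Diag A e α) (k : ℝ → ℝ) (y : H) :
    inner ℂ y (opFun k A y) = ((∑ i, k (α i) * ‖inner ℂ (e i) y‖ ^ 2 : ℝ) : ℂ) := by
  conv_lhs => rw [← e.sum_repr' y]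
  simp only [map_sum, map_smul, hA.opFun_apply, inner_sum, inner_smul_right]
  push_cast
  refine Finset.sum_congr rfl fun i _ => ?_
  rw [e.sum_repr' y, ← Complex.conj_mul', inner_conj_symm]
  ring

lemma fDiv_one_add_ketbra {A : H →ₗ[ℂ] H} {e : OrthonormalBasis ι ℂ H} {α : ι → ℝ}
    (hA : Diag A e α) {y : H} (hy : ‖y‖ = 1) :
    fDiv f A (1 + ketbra y y) =
      ((∑ i, f (α i) + ∑ i, perspDiff f (α i) * ‖inner ℂ (e i) y‖ ^ 2 : ℝ) : EReal) := by
  classical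
  obtain ⟨g, j, rfl⟩ := exists_basis_apply_eq hy
  have hB := diag_one_add_ketbra g j
  have hpos : ∀ k, 1 + (Pi.single j 1 : Fin (Module.finrank ℂ H) → ℝ) k ≠ 0 := fun k => by
    by_cases hk : k = j
    · subst hk; norm_num
    · simp [hk]
  have hs : supp A ≤ supp (1 + ketbra (g j) (g j)) := by
    rw [supp_le_iff hA hB]
    exact fun i k _ hk => absurd hk (hpos k)
  rw [fDiv_of_supp_le 0 hA hB hs, ← Finset.sum_add_distrib]
  congr 1
  refine Finset.sum_congr rfl fun i _ => ?_
  -- The second operator has eigenvalue `2` at `y` and `1` elsewhere, so `perspDiff` is the change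
  -- of the perspective from `b = 1` to `b = 2`.
  have h1 : ∀ k, pers f 0 (α i) (1 + (Pi.single j 1 : Fin (Module.finrank ℂ H) → ℝ) k) =
      f (α i) + if k = j then perspDiff f (α i) else 0 := fun k => by
    rw [pers_of_ne _ _ (hpos k)]
    split_ifs with hk
    · subst hk
      rw [Pi.single_eq_same, perspDiff, one_add_one_eq_two]
      ring
    · simp [hk]
  simp only [h1, add_mul, Finset.sum_add_distrib, ← Finset.mul_sum, sum_weight_right, mul_one,
    ite_mul, zero_mul, Finset.sum_ite_eq', Finset.mem_univ, if_true]

lemma fDiv_one_add_ketbra_self {x y : H} (hx : ‖x‖ = 1) (hy : ‖y‖ = 1) :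
    fDiv f (1 + ketbra x x) (1 + ketbra y y) =
      (((Module.finrank ℂ H - 1) * f 1 + f 2 + perspDiff f 1 +
        (perspDiff f 2 - perspDiff f 1) * ‖inner ℂ x y‖ ^ 2 : ℝ) : EReal) := by
  classical
  obtain ⟨e, i, rfl⟩ := exists_basis_apply_eq hx
  rw [fDiv_one_add_ketbra (diag_one_add_ketbra e i) hy]
  have h1 : ∀ (F : ℝ → ℝ) k, F (1 + (Pi.single i 1 : Fin (Module.finrank ℂ H) → ℝ) k) =
      F 1 + if k = i then F 2 - F 1 else 0 := fun F k => by
    split_ifs with hk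
    · subst hk
      rw [Pi.single_eq_same, one_add_one_eq_two]
      ring
    · simp [hk]
  have h2 : ∑ k, ‖inner ℂ (e k) y‖ ^ 2 = 1 := by rw [e.sum_sq_norm_inner_right, hy, one_pow]
  congr 1
  simp only [h1 f, h1 (perspDiff f), add_mul, Finset.sum_add_distrib, ← Finset.mul_sum, h2,
    ite_mul, zero_mul, Finset.sum_ite_eq', Finset.mem_univ, if_true, Finset.sum_const,
    Finset.card_univ, Fintype.card_fin, nsmul_eq_mul]
  ring

lemma exists_eq_one_add_ketbra (hf : StrictConvexOn ℝ (Set.Ici 0) f) {B : H →ₗ[ℂ] H}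
    {g : OrthonormalBasis ι ℂ H} {β : ι → ℝ} (hB : Diag B g β) (hβ : ∀ i, 1 ≤ β i)
    (htr : rtr B = Module.finrank ℂ H + 1)
    (h : (((Module.finrank ℂ H - 1) * f 1 + f 2 : ℝ) : EReal) ≤ fDiv f B 1) :
    ∃ y : H, ‖y‖ = 1 ∧ B = 1 + ketbra y y := by
  classical
  rw [fDiv_one_right hB, EReal.coe_le_coe_iff, Module.finrank_eq_card_basis g.toBasis] at h
  rw [hB.rtr_eq, Module.finrank_eq_card_basis g.toBasis] at htr
  obtain ⟨j, rfl⟩ := exists_eq_one_add_single hf hβ htr h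
  exact ⟨g j, g.norm_eq_one j, hB.ext (diag_one_add_ketbra g j)⟩

/-- Whenever `e i` and `g j` are not orthogonal, comparing matrix entries gives `k (α i) = k (β j)`,
hence `α i = β j`; so the entries of `A` and `B` agree too. -/
lemma eq_of_opFun_eq {k : ℝ → ℝ} (hk : Set.InjOn k (Set.Ici 0)) {A B : H →ₗ[ℂ] H}
    (hA : A.IsPositive) (hB : B.IsPositive) (h : opFun k A = opFun k B) : A = B := by
  obtain ⟨e, α, hA⟩ := exists_diag hA
  obtain ⟨g, β, hB⟩ := exists_diag hB
  refine g.toBasis.ext fun j => ?_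
  rw [g.coe_toBasis, hB.apply, ← e.sum_repr' (A (g j)), ← e.sum_repr' ((β j : ℂ) • g j)]
  refine Finset.sum_congr rfl fun i _ => ?_
  rw [hA.inner_apply, inner_smul_right]
  by_cases hij : inner ℂ (e i) (g j) = 0
  · simp [hij]
  · have h1 : inner ℂ (e i) (opFun k A (g j)) = ((k (β j) : ℝ) : ℂ) * inner ℂ (e i) (g j) := by
      rw [h, hB.opFun_apply, inner_smul_right]
    have h2 : inner ℂ (e i) (opFun k A (g j)) = ((k (α i) : ℝ) : ℂ) * inner ℂ (e i) (g j) := by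
      conv_lhs => rw [← e.sum_repr' (g j)]
      classical
      simp only [map_sum, map_smul, hA.opFun_apply, inner_sum, inner_smul_right, e.inner_eq_ite]
      simp [mul_comm]
    have h3 : k (α i) = k (β j) := by
      exact_mod_cast mul_right_cancel₀ hij (h2.symm.trans h1)
    rw [hk (hA.nonneg i) (hB.nonneg j) h3]

end DivergenceValues

/-! ### Wigner's theorem through coordinates -/

section Wigner

section Coordinates

open ComplexConjugate

variable {ι : Type*}

/-- The entries of the rank one matrix of a vector. -/
def gram (x : ι → ℂ) (j k : ι) : ℂ := conj (x j) * x k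

lemma norm_gram {σ : (ι → ℂ) → (ι → ℂ)} (hmod : ∀ x i, ‖σ x i‖ = ‖x i‖) (x : ι → ℂ) (j k : ι) :
    ‖gram (σ x) j k‖ = ‖gram x j k‖ := by
  simp only [gram, norm_mul, Complex.norm_conj, hmod]

lemma gram_self {σ : (ι → ℂ) → (ι → ℂ)} (hmod : ∀ x i, ‖σ x i‖ = ‖x i‖) (x : ι → ℂ) (j : ι) :
    gram (σ x) j j = gram x j j := by
  simp only [gram, Complex.conj_mul', hmod]

lemma exists_phase_of_gram_eq {a b : ι → ℂ} (h : ∀ j k, gram a j k = gram b j k) :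
    ∃ c : ℂ, ‖c‖ = 1 ∧ a = c • b := by
  have hnorm : ∀ j, ‖a j‖ = ‖b j‖ := fun j => by
    have h1 := congrArg norm (h j j)
    simp only [gram, norm_mul, Complex.norm_conj] at h1
    exact (mul_self_inj (norm_nonneg _) (norm_nonneg _)).1 h1
  by_cases hb : ∃ j, b j ≠ 0
  · obtain ⟨j, hj⟩ := hb
    have haj : a j ≠ 0 := by rwa [← norm_ne_zero_iff, hnorm, norm_ne_zero_iff]
    have haj' : conj (a j) ≠ 0 := (map_ne_zero _).2 haj
    refine ⟨conj (b j) / conj (a j), ?_, funext fun k => ?_⟩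
    · rw [norm_div, Complex.norm_conj, Complex.norm_conj, hnorm]
      exact div_self (norm_ne_zero_iff.2 hj)
    · have h1 := h j k
      simp only [gram] at h1
      rw [Pi.smul_apply, smul_eq_mul, div_mul_eq_mul_div, ← h1, mul_div_cancel_left₀ _ haj']
  · push Not at hb
    refine ⟨1, norm_one, funext fun j => ?_⟩
    rw [Pi.smul_apply, hb, smul_zero, ← norm_eq_zero, hnorm, hb, norm_zero]

lemma norm_sq_add_conj_mul (a b c d : ℂ) :
    ‖conj a * c + conj b * d‖ ^ 2 = ‖a‖ ^ 2 * ‖c‖ ^ 2 + ‖b‖ ^ 2 * ‖d‖ ^ 2 +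
      2 * (conj (conj a * b) * (conj c * d)).re := by
  simp only [Complex.sq_norm, Complex.normSq_apply, Complex.add_re, Complex.add_im, Complex.mul_re,
    Complex.mul_im, Complex.conj_re, Complex.conj_im]
  ring

variable [Fintype ι] [DecidableEq ι]

lemma sum_conj_mul_of_support {j k : ι} (hjk : j ≠ k) {x : ι → ℂ}
    (hx : ∀ i, i ≠ j → i ≠ k → x i = 0) (y : ι → ℂ) :
    ∑ i, conj (x i) * y i = conj (x j) * y j + conj (x k) * y k := by
  rw [← Finset.sum_pair hjk (f := fun i => conj (x i) * y i)]
  refine (Finset.sum_subset (Finset.subset_univ _) fun i _ hi => ?_).symm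
  simp only [Finset.mem_insert, Finset.mem_singleton, not_or] at hi
  rw [hx i hi.1 hi.2, map_zero, zero_mul]

variable {σ : (ι → ℂ) → (ι → ℂ)}

/-- Expanding the squared modulus of a two-term inner product, all but the cross term depend only on
moduli of coordinates, which `σ` preserves. -/
lemma re_gram_mul_gram (h : ∀ x y, ‖∑ i, conj (σ x i) * σ y i‖ = ‖∑ i, conj (x i) * y i‖)
    (hmod : ∀ x i, ‖σ x i‖ = ‖x i‖) {j k : ι} (hjk : j ≠ k) {x : ι → ℂ}
    (hx : ∀ i, i ≠ j → i ≠ k → x i = 0) (y : ι → ℂ) :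
    (conj (gram (σ x) j k) * gram (σ y) j k).re = (conj (gram x j k) * gram y j k).re := by
  have hx' : ∀ i, i ≠ j → i ≠ k → σ x i = 0 := fun i hi hi' => by
    rw [← norm_eq_zero, hmod, hx i hi hi', norm_zero]
  have h1 := congrArg (· ^ 2) (h x y)
  simp only [sum_conj_mul_of_support hjk hx, sum_conj_mul_of_support hjk hx',
    norm_sq_add_conj_mul, hmod] at h1
  simp only [gram]
  linarith

lemma re_gram (h : ∀ x y, ‖∑ i, conj (σ x i) * σ y i‖ = ‖∑ i, conj (x i) * y i‖)
    (hmod : ∀ x i, ‖σ x i‖ = ‖x i‖) (hone : σ 1 = 1) (y : ι → ℂ) (j k : ι) :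
    (gram (σ y) j k).re = (gram y j k).re := by
  rcases eq_or_ne j k with rfl | hjk
  · rw [gram_self hmod]
  let x : ι → ℂ := fun i => if i = j ∨ i = k then 1 else 0
  have hx : ∀ i, i ≠ j → i ≠ k → x i = 0 := fun i hi hi' => by simp [x, hi, hi']
  have hg : gram x j k = 1 := by simp [gram, x]
  have h1 := re_gram_mul_gram h hmod hjk hx 1
  have h2 := norm_gram hmod x j k
  have h3 : gram (1 : ι → ℂ) j k = 1 := by simp [gram]
  rw [hone, hg, h3] at h1
  rw [hg, norm_one] at h2
  simp only [map_one, mul_one, Complex.conj_re, Complex.one_re] at h1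
  have h4 : gram (σ x) j k = 1 := by
    refine Complex.ext h1 ?_
    have h5 := Complex.sq_norm (gram (σ x) j k)
    rw [h2, Complex.normSq_apply, h1] at h5
    rw [Complex.one_im]
    nlinarith
  have h6 := re_gram_mul_gram h hmod hjk hx y
  simpa [h4, hg] using h6

/-- Real parts are already preserved, so only the signs of imaginary parts are open. A vector with
entries `1, I` at `j, k` compares the sign for `y` with that for the probe `p`, whose entries never
have vanishing imaginary part off the diagonal. The comparison also forces `s = ±1`. -/
lemma im_gram_of_probe (h : ∀ x y, ‖∑ i, conj (σ x i) * σ y i‖ = ‖∑ i, conj (x i) * y i‖)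
    (hmod : ∀ x i, ‖σ x i‖ = ‖x i‖) (hone : σ 1 = 1) {p : ι → ℂ} {s : ℝ}
    (hp : ∀ j k, j ≠ k → (gram p j k).im ≠ 0)
    (hsp : ∀ j k, (gram (σ p) j k).im = s * (gram p j k).im) (y : ι → ℂ) (j k : ι) :
    s * (gram (σ y) j k).im = (gram y j k).im := by
  rcases eq_or_ne j k with rfl | hjk
  · rw [gram_self hmod]
    simp [gram, Complex.conj_mul', ← Complex.ofReal_pow]
  let x : ι → ℂ := fun i => if i = j then 1 else if i = k then Complex.I else 0
  have hx : ∀ i, i ≠ j → i ≠ k → x i = 0 := fun i hi hi' => by simp [x, hi, hi']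
  have hg : gram x j k = Complex.I := by simp [gram, x, hjk.symm]
  have h1 := re_gram_mul_gram h hmod hjk hx p
  have h2 := re_gram h hmod hone x j k
  have h3 := re_gram_mul_gram h hmod hjk hx y
  rw [hg] at h1 h2 h3
  rw [Complex.I_re] at h2
  simp only [Complex.mul_re, Complex.conj_re, Complex.conj_im, h2, hsp, Complex.I_re,
    Complex.I_im] at h1 h3
  have h4 : (gram (σ x) j k).im * s = 1 := by
    refine mul_right_cancel₀ (hp j k hjk) ?_
    linarith
  have h5 : (gram (σ x) j k).im ^ 2 = 1 := by
    have h6 := Complex.sq_norm (gram (σ x) j k)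
    rw [norm_gram hmod, hg, Complex.norm_I, Complex.normSq_apply, h2] at h6
    linarith
  have h7 : s = (gram (σ x) j k).im := by
    calc s = (gram (σ x) j k).im ^ 2 * s := by rw [h5, one_mul]
      _ = (gram (σ x) j k).im * ((gram (σ x) j k).im * s) := by ring
      _ = _ := by rw [h4, mul_one]
  rw [h7]
  linarith

lemma wigner_coordinates {n : ℕ} {σ : (Fin n → ℂ) → (Fin n → ℂ)}
    (h : ∀ x y, ‖∑ i, conj (σ x i) * σ y i‖ = ‖∑ i, conj (x i) * y i‖)
    (hmod : ∀ x i, ‖σ x i‖ = ‖x i‖) (hone : σ 1 = 1) :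
    (∀ x, ∃ c : ℂ, ‖c‖ = 1 ∧ σ x = c • x) ∨ (∀ x, ∃ c : ℂ, ‖c‖ = 1 ∧ σ x = c • star x) := by
  rcases Nat.eq_zero_or_pos n with rfl | hn
  · exact Or.inl fun x => ⟨1, norm_one, Subsingleton.elim _ _⟩
  let o : Fin n := ⟨0, hn⟩
  -- The coordinates `1 + j * I` give `gram p j k = (1 + j * k) + (k - j) * I`, which is not real
  -- off the diagonal.
  let p : Fin n → ℂ := fun j => ⟨1, (j : ℕ)⟩
  have hpre : ∀ j k, (gram p j k).re = 1 + (j : ℕ) * (k : ℕ) := fun j k => by simp [gram, p]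
  have hpim : ∀ j k, (gram p j k).im = (k : ℕ) - (j : ℕ) := fun j k => by
    simp [gram, p]
    ring
  have hpo : ‖σ p o‖ = 1 := by
    rw [hmod]
    have : p o = 1 := Complex.ext rfl (by simp [p, o])
    rw [this, norm_one]
  have hcoc : ∀ j k, gram (σ p) j k = conj (gram (σ p) o j) * gram (σ p) o k := fun j k => by
    have h1 : σ p o * conj (σ p o) = 1 := by
      rw [Complex.mul_conj', hpo]
      norm_num
    simp only [gram, map_mul, Complex.conj_conj]
    linear_combination -(conj (σ p j) * σ p k) * h1
  have hre := re_gram h hmod hone p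
  have hre0 : ∀ j, (gram (σ p) o j).re = 1 := fun j => by
    rw [hre, hpre]
    simp [o]
  have him : ∀ j k, (gram (σ p) j k).im = (gram (σ p) o k).im - (gram (σ p) o j).im :=
    fun j k => by
      rw [hcoc j k]
      simp only [Complex.mul_im, Complex.conj_re, Complex.conj_im, hre0]
      ring
  -- With `t j` the imaginary part of entry `(o, j)`, the rank one structure gives real part `1 + t
  -- j * t k` at `(j, k)`. So `t j * t k = j * k`, and one sign serves all indices: `+` is the
  -- linear case, `-` the conjugate-linear one.
  have hprod : ∀ j k, (gram (σ p) o j).im * (gram (σ p) o k).im = (j : ℕ) * (k : ℕ) :=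
    fun j k => by
      have h1 := hre j k
      rw [hcoc j k, hpre] at h1
      simp only [Complex.mul_re, Complex.conj_re, Complex.conj_im, hre0] at h1
      linarith
  have hp : ∀ j k, j ≠ k → (gram p j k).im ≠ 0 := fun j k hjk => by
    rw [hpim, sub_ne_zero]
    exact fun h' => hjk (Fin.ext (Nat.cast_injective h').symm)
  by_cases hall : ∀ k, (gram (σ p) o k).im = (k : ℕ)
  · left
    intro x
    refine exists_phase_of_gram_eq fun j k => Complex.ext (re_gram h hmod hone x j k) ?_
    have h1 := im_gram_of_probe h hmod hone (s := 1) hp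
      (fun j k => by rw [him, hall, hall, hpim, one_mul]) x j k
    rwa [one_mul] at h1
  · right
    push Not at hall
    obtain ⟨j, hj⟩ := hall
    have hj' : (gram (σ p) o j).im = -(j : ℕ) :=
      (mul_self_eq_mul_self_iff.1 (hprod j j)).resolve_left hj
    have hj0 : ((j : ℕ) : ℝ) ≠ 0 := fun h0 => hj (by rw [hj', h0, neg_zero])
    have hall : ∀ k, (gram (σ p) o k).im = -(k : ℕ) := fun k => by
      have h1 := hprod j k
      rw [hj'] at h1
      refine mul_left_cancel₀ hj0 ?_
      linarith
    intro x
    have h0 : ∀ j k, gram (star x) j k = conj (gram x j k) := fun j k => by simp [gram]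
    refine exists_phase_of_gram_eq fun j k => ?_
    rw [h0]
    refine Complex.ext (re_gram h hmod hone x j k) ?_
    have h1 := im_gram_of_probe h hmod hone (s := -1) hp
      (fun j k => by rw [him, hall, hall, hpim]; ring) x j k
    rw [Complex.conj_im]
    linarith

end Coordinates

/-- Coordinatewise complex conjugation. -/
def conjEuclidean (ι : Type*) [Fintype ι] :
    EuclideanSpace ℂ ι ≃ₛₗᵢ[starRingEnd ℂ] EuclideanSpace ℂ ι where
  toFun x := WithLp.toLp 2 (star x.ofLp)
  invFun x := WithLp.toLp 2 (star x.ofLp)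
  map_add' x y := by ext; simp
  map_smul' c x := by ext; simp
  left_inv x := by ext; simp
  right_inv x := by ext; simp
  norm_map' x := by simp [EuclideanSpace.norm_eq]

variable {H : Type*} [NormedAddCommGroup H] [InnerProductSpace ℂ H] [FiniteDimensional ℂ H]

lemma exists_adapted_basis {ι : Type*} [Fintype ι] (e : OrthonormalBasis ι ℂ H) {τ : H → H}
    (hτ : ∀ x y, ‖inner ℂ (τ x) (τ y)‖ = ‖inner ℂ x y‖) :
    ∃ g : OrthonormalBasis ι ℂ H, (∀ x i, ‖inner ℂ (g i) (τ x)‖ = ‖inner ℂ (e i) x‖) ∧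
      ∀ i, inner ℂ (g i) (τ (∑ i, e i)) = 1 := by
  classical
  have hc : ∀ i, ‖inner ℂ (τ (e i)) (τ (∑ i, e i))‖ = 1 := fun i => by
    rw [hτ, inner_sum, Finset.sum_eq_single i (fun j _ hj => e.inner_eq_zero hj.symm) (by simp)]
    simp
  -- These unimodular phases are absorbed into the new basis, so that the image of `∑ i, e i` gets
  -- all coordinates `1`.
  set c : ι → ℂ := fun i => inner ℂ (τ (e i)) (τ (∑ i, e i)) with hcdef
  have hon : Orthonormal ℂ fun i => c i • τ (e i) := by
    constructor
    · intro i
      have h1 := hτ (e i) (e i)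
      rw [inner_self_eq_norm_sq_to_K, inner_self_eq_norm_sq_to_K, e.norm_eq_one] at h1
      have h2 : ‖τ (e i)‖ ^ 2 = 1 := by simpa using h1
      rw [norm_smul, hc, one_mul]
      exact (pow_eq_one_iff_of_nonneg (norm_nonneg _) two_ne_zero).1 h2
    · intro i j hij
      rw [inner_smul_left, inner_smul_right, ← norm_eq_zero, norm_mul, norm_mul, hτ (e i) (e j),
        e.inner_eq_zero hij]
      simp
  have hcard : Fintype.card ι = Module.finrank ℂ H :=
    (Module.finrank_eq_card_basis e.toBasis).symm
  have hspan := hon.linearIndependent.span_eq_top_of_card_eq_finrank' hcard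
  refine ⟨OrthonormalBasis.mk hon hspan.ge, fun x i => ?_, fun i => ?_⟩
  · rw [OrthonormalBasis.coe_mk, inner_smul_left, norm_mul, Complex.norm_conj, hc, one_mul, hτ]
  · rw [OrthonormalBasis.coe_mk, inner_smul_left]
    change (starRingEnd ℂ) (c i) * c i = 1
    rw [Complex.conj_mul', hc]
    norm_num

/-- Wigner's theorem in finite dimension. -/
theorem wigner {τ : H → H} (hτ : ∀ x y, ‖inner ℂ (τ x) (τ y)‖ = ‖inner ℂ x y‖) :
    (∃ U : H ≃ₗᵢ[ℂ] H, ∀ x, ∃ c : ℂ, ‖c‖ = 1 ∧ τ x = c • U x) ∨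
    (∃ U : H ≃ₛₗᵢ[starRingEnd ℂ] H, ∀ x, ∃ c : ℂ, ‖c‖ = 1 ∧ τ x = c • U x) := by
  let e := stdOrthonormalBasis ℂ H
  obtain ⟨g, hg1, hg2⟩ := exists_adapted_basis e hτ
  let σ : (Fin (Module.finrank ℂ H) → ℂ) → (Fin (Module.finrank ℂ H) → ℂ) :=
    fun x i => g.repr (τ (e.repr.symm (WithLp.toLp 2 x))) i
  have hsum : ∀ (b : OrthonormalBasis (Fin (Module.finrank ℂ H)) ℂ H) (u v : H),
      ∑ i, (starRingEnd ℂ) (b.repr u i) * b.repr v i = inner ℂ u v := fun b u v => by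
    rw [← b.sum_inner_mul_inner u v]
    refine Finset.sum_congr rfl fun i _ => ?_
    rw [b.repr_apply_apply, b.repr_apply_apply, inner_conj_symm]
  have hrepr : ∀ (x : Fin (Module.finrank ℂ H) → ℂ) i,
      e.repr (e.repr.symm (WithLp.toLp 2 x)) i = x i := fun x i => by simp
  have h1 : ∀ x y, ‖∑ i, (starRingEnd ℂ) (σ x i) * σ y i‖ =
      ‖∑ i, (starRingEnd ℂ) (x i) * y i‖ := fun x y => by
    rw [hsum g, hτ, ← hsum e]
    simp only [hrepr]
  have h2 : ∀ x i, ‖σ x i‖ = ‖x i‖ := fun x i => by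
    simp only [σ]
    rw [g.repr_apply_apply, hg1, ← e.repr_apply_apply, hrepr]
  have h3 : σ 1 = 1 := by
    funext i
    simp only [σ]
    have h4 : e.repr.symm (WithLp.toLp 2 1) = ∑ i, e i := by
      rw [← e.sum_repr (e.repr.symm (WithLp.toLp 2 1))]
      simp only [hrepr, Pi.one_apply, one_smul]
    rw [g.repr_apply_apply, h4, hg2, Pi.one_apply]
  have hσ : ∀ x : H, g.repr (τ x) = WithLp.toLp 2 (σ (e.repr x).ofLp) := fun x => by
    ext i
    simp [σ]
  rcases wigner_coordinates h1 h2 h3 with h | h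
  · refine Or.inl ⟨e.repr.trans g.repr.symm, fun x => ?_⟩
    obtain ⟨c, hc, hcx⟩ := h (e.repr x).ofLp
    refine ⟨c, hc, g.repr.injective ?_⟩
    rw [hσ, hcx, map_smul]
    ext i
    simp
  · refine Or.inr ⟨(e.repr.trans (conjEuclidean _)).trans g.repr.symm, fun x => ?_⟩
    obtain ⟨c, hc, hcx⟩ := h (e.repr x).ofLp
    refine ⟨c, hc, g.repr.injective ?_⟩
    rw [hσ, hcx, map_smul]
    ext i
    simp [conjEuclidean]

end Wigner

/-! ### Rigidity of divergence-preserving bijections -/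

section PreservingMaps

variable {H : Type*} [NormedAddCommGroup H] [InnerProductSpace ℂ H] [FiniteDimensional ℂ H]
variable {f : ℝ → ℝ} {φ : PSD H → PSD H}

lemma isPositive_zero : (0 : H →ₗ[ℂ] H).IsPositive :=
  (diag_zero (stdOrthonormalBasis ℂ H)).isPositive

lemma isPositive_one : (1 : H →ₗ[ℂ] H).IsPositive :=
  (diag_one (stdOrthonormalBasis ℂ H)).isPositive

lemma isPositive_smul {A : H →ₗ[ℂ] H} (hA : A.IsPositive) {c : ℝ} (hc : 0 ≤ c) :
    ((c : ℂ) • A).IsPositive := by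
  obtain ⟨e, α, h⟩ := exists_diag hA
  exact (h.smul hc).isPositive

lemma map_zero_of_tendsto_atTop (hf : StrictConvexOn ℝ (Set.Ici 0) f)
    (hω : Tendsto (fun x => f x / x) atTop atTop) (hφ : Function.Bijective φ)
    (hpres : ∀ A B : PSD H, fDiv f (φ A).1 (φ B).1 = fDiv f A.1 B.1) :
    (φ ⟨0, isPositive_zero⟩).1 = 0 := by
  set Z := φ ⟨0, isPositive_zero⟩ with hZ
  by_contra hne
  -- The divergence of `2Z` relative to `Z` is finite, while that of a nonzero operator relative to
  -- `0` is `⊤`.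
  obtain ⟨A, hA⟩ := hφ.2 ⟨((2 : ℝ) : ℂ) • Z.1, isPositive_smul Z.2 zero_le_two⟩
  have hA0 : A.1 ≠ 0 := by
    intro h0
    have h1 : φ A = Z := by
      rw [hZ]
      exact congrArg φ (Subtype.ext h0)
    rw [hA, Subtype.ext_iff] at h1
    have h2 : ((2 : ℝ) : ℂ) • Z.1 = (1 : ℂ) • Z.1 := by rw [one_smul]; exact h1
    rw [← sub_eq_zero, ← sub_smul, smul_eq_zero] at h2
    rcases h2 with h2 | h2
    · norm_num at h2
    · exact hne h2
  have h1 := hpres A ⟨0, isPositive_zero⟩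
  obtain ⟨e, α, hd⟩ := exists_diag A.2
  rw [← hZ, hA, fDiv_smul_self Z.2 zero_le_two,
    fDiv_of_tendsto_atTop hf hω hd (diag_zero e) fun h => hA0 (supp_le_zero h)] at h1
  exact EReal.coe_ne_top _ h1

/-- With finite slope, the symmetrized divergence satisfies a triangle inequality through `0`. It
transfers to `Z = φ 0` by surjectivity. For `Z ≠ 0` it fails at the pair `0`, `2Z`, because `f 2 < f
1 + ω` and `2 * f (1 / 2) ≤ f 0 + f 1`. -/
lemma map_zero_of_tendsto (hf : StrictConvexOn ℝ (Set.Ici 0) f) {ω : ℝ}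
    (hω : Tendsto (fun x => f x / x) atTop (𝓝 ω)) (hφ : Function.Bijective φ)
    (hpres : ∀ A B : PSD H, fDiv f (φ A).1 (φ B).1 = fDiv f A.1 B.1) :
    (φ ⟨0, isPositive_zero⟩).1 = 0 := by
  have hex : ∃ s : PSD H → PSD H → ℝ, ∀ A B, fDiv f A.1 B.1 = s A B := by
    choose s hs using fun A B : PSD H => exists_fDiv_eq_coe hf hω A.2 B.2
    exact ⟨s, hs⟩
  obtain ⟨s, hs⟩ := hex
  have hval : ∀ {A B : PSD H} {r : ℝ}, fDiv f A.1 B.1 = r → s A B = r := fun {A B r} h => by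
    rw [hs] at h
    exact EReal.coe_injective h
  have hpres' : ∀ A B, s (φ A) (φ B) = s A B := fun A B => hval (by rw [hpres, hs])
  set O : PSD H := ⟨0, isPositive_zero⟩
  have hO1 : ∀ A, s A O = ω * rtr A.1 := fun A => hval (fDiv_zero_right hf hω A.2)
  have hO2 : ∀ A, s O A = f 0 * rtr A.1 := fun A => hval (fDiv_zero_left A.2)
  have hself : ∀ A, s A A = f 1 * rtr A.1 := fun A => hval (fDiv_self A.2)
  have hle : ∀ A B, s A B ≤ ω * rtr A.1 + f 0 * rtr B.1 := fun A B => by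
    have := fDiv_le hf hω A.2 B.2
    rwa [hs, EReal.coe_le_coe_iff] at this
  have htriO : ∀ B C, s B C + s C B + 2 * s O O ≤ s B O + s O B + (s C O + s O C) := fun B C => by
    have h0 : s O O = 0 := by rw [hself]; simp [rtr, O]
    rw [h0, hO1, hO1, hO2, hO2]
    linarith [hle B C, hle C B]
  set Z := φ O with hZ
  have htri : ∀ B C, s B C + s C B + 2 * s Z Z ≤ s B Z + s Z B + (s C Z + s Z C) := fun B C => by
    obtain ⟨B, rfl⟩ := hφ.2 B
    obtain ⟨C, rfl⟩ := hφ.2 C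
    simpa only [hZ, hpres'] using htriO B C
  by_contra hne
  have htr : 0 < rtr Z.1 := (rtr_nonneg Z.2).lt_of_ne' fun h => hne ((rtr_eq_zero_iff Z.2).1 h)
  let Y : PSD H := ⟨((2 : ℝ) : ℂ) • Z.1, isPositive_smul Z.2 zero_le_two⟩
  have hYtr : rtr Y.1 = 2 * rtr Z.1 := rtr_smul 2 Z.1
  have hYZ : s Y Z = f 2 * rtr Z.1 := hval (fDiv_smul_self Z.2 zero_le_two)
  have hZY : s Z Y = f (1 / 2) * (2 * rtr Z.1) := by
    rw [← hYtr]
    have h1 := fDiv_smul_self (f := f) Y.2 (c := 1 / 2) (by norm_num)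
    have h2 : ((1 / 2 : ℝ) : ℂ) • Y.1 = Z.1 := by
      rw [smul_smul]
      norm_num
    rw [h2] at h1
    exact hval h1
  have h1 := htri O Y
  rw [hself, hO1, hO2, hO1, hO2, hYZ, hZY, hYtr] at h1
  have h2 := lt_add_slope_mul hf hω zero_le_one one_lt_two
  have h3 : f ((1 / 2 : ℝ) • 0 + (1 / 2 : ℝ) • 1) ≤ (1 / 2 : ℝ) • f 0 + (1 / 2 : ℝ) • f 1 :=
    hf.convexOn.2 (by simp) (by simp) (by norm_num) (by norm_num) (by norm_num)
  simp only [smul_eq_mul, mul_zero, zero_add, mul_one] at h3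
  have h4 : 0 < (f 0 + f 1 + ω - f 2 + (f 1 - 2 * f (1 / 2))) * rtr Z.1 :=
    mul_pos (by linarith) htr
  nlinarith

lemma map_zero_eq (hf : StrictConvexOn ℝ (Set.Ici 0) f) (hφ : Function.Bijective φ)
    (hpres : ∀ A B : PSD H, fDiv f (φ A).1 (φ B).1 = fDiv f A.1 B.1) :
    φ ⟨0, isPositive_zero⟩ = ⟨0, isPositive_zero⟩ := by
  rcases exists_slope_limit hf with ⟨ω, hω⟩ | hω
  · exact Subtype.ext (map_zero_of_tendsto hf hω hφ hpres)
  · exact Subtype.ext (map_zero_of_tendsto_atTop hf hω hφ hpres)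

lemma exists_isGLB_neg (hf : StrictConvexOn ℝ (Set.Ici 0) f) (h0 : f 0 = 0) (h1 : f 1 = 0) :
    ∃ m < 0, IsGLB (f '' Set.Ici 0) m := by
  have hbdd : BddBelow (f '' Set.Ici 0) := by
    refine ⟨-|f 2|, ?_⟩
    rintro _ ⟨x, hx, rfl⟩
    rw [Set.mem_Ici] at hx
    rcases lt_trichotomy x 1 with hx1 | rfl | hx1
    -- To the left of `1`, `f` lies above the line through its points at `1` and `2`.
    · have h2 := hf.secant_strict_mono (a := 1) (x := x) (y := 2) (by simp) hx (by simp)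
        hx1.ne (by norm_num) (by linarith)
      rw [h1, sub_zero, sub_zero, div_lt_iff_of_neg (by linarith)] at h2
      norm_num at h2
      have h3 := le_abs_self (f 2)
      have h4 := neg_abs_le (f 2)
      nlinarith [abs_nonneg (f 2)]
    · rw [h1]
      simp
    · have h2 := secant_lt hf one_pos hx1
      rw [h0, h1, sub_self, zero_div, sub_zero, lt_div_iff₀ (by linarith), zero_mul] at h2
      linarith [abs_nonneg (f 2)]
  have hhalf : f ((1 / 2 : ℝ) • 0 + (1 / 2 : ℝ) • 1) < (1 / 2 : ℝ) • f 0 + (1 / 2 : ℝ) • f 1 :=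
    hf.2 (by simp) (by simp) (by norm_num) (by norm_num) (by norm_num) (by norm_num)
  simp only [smul_eq_mul, mul_zero, zero_add, mul_one, h0, h1] at hhalf
  refine ⟨sInf (f '' Set.Ici 0), ?_, isGLB_csInf ⟨_, 0, by simp, rfl⟩ hbdd⟩
  exact (csInf_le hbdd ⟨1 / 2, by norm_num, rfl⟩).trans_lt hhalf

/-- Relative to `C`, all divergences are at least `m * rtr C`, whereas the multiples `c • B` give
values `f c * rtr B` with infimum `m * rtr B` relative to `B`. The sign of `m` reverses the
inequality. -/
lemma rtr_le_of_isGLB (hf : StrictConvexOn ℝ (Set.Ici 0) f)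
    (hω : Tendsto (fun x => f x / x) atTop atTop) {m : ℝ} (hm : m < 0)
    (hglb : IsGLB (f '' Set.Ici 0) m) {B C : PSD H}
    (h : ∀ A : PSD H, ∃ A' : PSD H, fDiv f A'.1 C.1 = fDiv f A.1 B.1) : rtr B.1 ≤ rtr C.1 := by
  have h1 : ∀ c, 0 ≤ c → m * rtr C.1 ≤ f c * rtr B.1 := fun c hc => by
    obtain ⟨A', hA'⟩ := h ⟨(c : ℂ) • B.1, isPositive_smul B.2 hc⟩
    rw [fDiv_smul_self B.2 hc] at hA'
    have h2 := le_fDiv hf hω (fun x hx => hglb.1 ⟨x, hx, rfl⟩) A'.2 C.2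
    rwa [hA', EReal.coe_le_coe_iff] at h2
  rcases (rtr_nonneg B.2).eq_or_lt with hB | hB
  · rw [← hB]
    exact rtr_nonneg C.2
  have h2 : m * rtr C.1 / rtr B.1 ≤ m := by
    refine hglb.2 ?_
    rintro _ ⟨c, hc, rfl⟩
    exact (div_le_iff₀ hB).2 (h1 c hc)
  rw [div_le_iff₀ hB] at h2
  exact (mul_le_mul_left_of_neg hm).1 h2

lemma rtr_map (hf : StrictConvexOn ℝ (Set.Ici 0) f) (hφ : Function.Bijective φ)
    (hpres : ∀ A B : PSD H, fDiv f (φ A).1 (φ B).1 = fDiv f A.1 B.1) (B : PSD H) :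
    rtr (φ B).1 = rtr B.1 := by
  have hzero := map_zero_eq hf hφ hpres
  by_cases h0 : f 0 = 0
  · by_cases h1 : f 1 = 0
    · rcases exists_slope_limit hf with ⟨ω, hω⟩ | hω
      · have h2 := lt_add_slope_mul hf hω le_rfl one_pos
        rw [h0, h1, zero_add, sub_zero, mul_one] at h2
        have h3 := hpres B ⟨0, isPositive_zero⟩
        rw [hzero, fDiv_zero_right hf hω (φ B).2, fDiv_zero_right hf hω B.2] at h3
        exact mul_left_cancel₀ h2.ne' (EReal.coe_injective h3)
      · obtain ⟨m, hm, hglb⟩ := exists_isGLB_neg hf h0 h1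
        refine le_antisymm (rtr_le_of_isGLB hf hω hm hglb fun A => ?_)
          (rtr_le_of_isGLB hf hω hm hglb fun A => ⟨φ A, hpres A B⟩)
        obtain ⟨A, rfl⟩ := hφ.2 A
        exact ⟨A, (hpres A B).symm⟩
    · have h3 := hpres B B
      rw [fDiv_self (φ B).2, fDiv_self B.2] at h3
      exact mul_left_cancel₀ h1 (EReal.coe_injective h3)
  · have h3 := hpres ⟨0, isPositive_zero⟩ B
    rw [hzero, fDiv_zero_left (φ B).2, fDiv_zero_left B.2] at h3
    exact mul_left_cancel₀ h0 (EReal.coe_injective h3)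

/-- The criterion `one_le_eigenvalues_iff` mentions only traces and divergences, and both are
preserved. -/
lemma one_le_eigenvalues_map (hf : StrictConvexOn ℝ (Set.Ici 0) f) (hφ : Function.Bijective φ)
    (hpres : ∀ A B : PSD H, fDiv f (φ A).1 (φ B).1 = fDiv f A.1 B.1) {ι κ : Type*} [Fintype ι]
    [Fintype κ] {B : PSD H} {e : OrthonormalBasis ι ℂ H} {α : ι → ℝ} {g : OrthonormalBasis κ ℂ H}
    {β : κ → ℝ} (hB : Diag B.1 e α) (hB' : Diag (φ B).1 g β) (h : ∀ i, 1 ≤ α i) (j : κ) :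
    1 ≤ β j := by
  refine (one_le_eigenvalues_iff hf hB').1 (fun A hA htr => ?_) j
  obtain ⟨A', hA'⟩ := hφ.2 ⟨A, hA⟩
  obtain rfl : (φ A').1 = A := congrArg Subtype.val hA'
  rw [rtr_map hf hφ hpres] at htr
  rw [hpres, rtr_map hf hφ hpres]
  exact (one_le_eigenvalues_iff hf hB).2 h A' A'.2 htr

lemma map_one_eq (hf : StrictConvexOn ℝ (Set.Ici 0) f) (hφ : Function.Bijective φ)
    (hpres : ∀ A B : PSD H, fDiv f (φ A).1 (φ B).1 = fDiv f A.1 B.1) :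
    (φ ⟨1, isPositive_one⟩).1 = 1 := by
  obtain ⟨g, β, hg⟩ := exists_diag (φ ⟨1, isPositive_one⟩).2
  have h1 := one_le_eigenvalues_map hf hφ hpres (B := ⟨1, isPositive_one⟩) (diag_one g) hg
    (fun _ => le_rfl)
  have h2 := rtr_map hf hφ hpres ⟨1, isPositive_one⟩
  rw [hg.rtr_eq, (diag_one g).rtr_eq] at h2
  -- Eigenvalues at least `1` whose sum is the dimension must all equal `1`.
  have h3 := (Finset.sum_eq_sum_iff_of_le fun i _ => h1 i).1 h2.symm
  obtain rfl : β = fun _ => 1 := funext fun i => (h3 i (Finset.mem_univ i)).symm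
  exact hg.ext (diag_one g)

lemma exists_map_one_add_ketbra (hf : StrictConvexOn ℝ (Set.Ici 0) f) (hφ : Function.Bijective φ)
    (hpres : ∀ A B : PSD H, fDiv f (φ A).1 (φ B).1 = fDiv f A.1 B.1) {y : H} (hy : ‖y‖ = 1) :
    ∃ z : H, ‖z‖ = 1 ∧ (φ ⟨1 + ketbra y y, isPositive_one_add_ketbra hy⟩).1 = 1 + ketbra z z := by
  classical
  obtain ⟨e, j, hj⟩ := exists_basis_apply_eq hy
  have hd := diag_one_add_ketbra e j
  rw [hj] at hd
  set B : PSD H := ⟨1 + ketbra y y, isPositive_one_add_ketbra hy⟩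
  obtain ⟨g, β, hg⟩ := exists_diag (φ B).2
  have hsum : ∀ F : ℝ → ℝ, ∑ k, F (1 + (Pi.single j 1 : Fin (Module.finrank ℂ H) → ℝ) k) =
      (Module.finrank ℂ H - 1) * F 1 + F 2 := fun F => by
    have h1 : ∀ k, F (1 + (Pi.single j 1 : Fin (Module.finrank ℂ H) → ℝ) k) =
        F 1 + if k = j then F 2 - F 1 else 0 := fun k => by
      split_ifs with hk
      · subst hk
        rw [Pi.single_eq_same, one_add_one_eq_two]
        ring
      · simp [hk]
    simp only [h1, Finset.sum_add_distrib, Finset.sum_ite_eq', Finset.mem_univ, if_true,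
      Finset.sum_const, Finset.card_univ, Fintype.card_fin, nsmul_eq_mul]
    ring
  refine exists_eq_one_add_ketbra hf hg
    (one_le_eigenvalues_map hf hφ hpres (B := B) hd hg fun k => ?_) ?_ ?_
  · by_cases hk : k = j
    · subst hk; simp
    · simp [hk]
  · rw [rtr_map hf hφ hpres, hd.rtr_eq, hsum fun x => x]
    ring
  · have h1 := hpres B ⟨1, isPositive_one⟩
    rw [map_one_eq hf hφ hpres, fDiv_one_right hd, hsum] at h1
    exact h1.ge

lemma exists_wigner_map (hf : StrictConvexOn ℝ (Set.Ici 0) f) (hφ : Function.Bijective φ)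
    (hpres : ∀ A B : PSD H, fDiv f (φ A).1 (φ B).1 = fDiv f A.1 B.1) :
    ∃ τ : H → H, (∀ x y, ‖inner ℂ (τ x) (τ y)‖ = ‖inner ℂ x y‖) ∧ ∀ (A : PSD H) (y : H), ‖y‖ = 1 →
      fDiv f (φ A).1 (1 + ketbra (τ y) (τ y)) = fDiv f A.1 (1 + ketbra y y) := by
  choose! t ht1 ht2 using fun y (hy : ‖y‖ = 1) => exists_map_one_add_ketbra hf hφ hpres hy
  have hunit : ∀ x y, ‖x‖ = 1 → ‖y‖ = 1 → ‖inner ℂ (t x) (t y)‖ = ‖inner ℂ x y‖ :=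
    fun x y hx hy => by
      have h1 := hpres ⟨_, isPositive_one_add_ketbra hx⟩ ⟨_, isPositive_one_add_ketbra hy⟩
      rw [ht2 x hx, ht2 y hy, fDiv_one_add_ketbra_self (ht1 x hx) (ht1 y hy),
        fDiv_one_add_ketbra_self hx hy] at h1
      have h2 := add_left_cancel (EReal.coe_injective h1)
      have hk : perspDiff f 2 - perspDiff f 1 ≠ 0 :=
        sub_ne_zero.2 (persp_diff_strictAnti hf zero_le_one one_lt_two).ne
      exact (pow_left_inj₀ (norm_nonneg _) (norm_nonneg _) two_ne_zero).1 (mul_left_cancel₀ hk h2)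
  -- The map of unit vectors is extended by positive homogeneity.
  refine ⟨fun x => (‖x‖ : ℂ) • t ((‖x‖⁻¹ : ℂ) • x), fun x y => ?_, fun A y hy => ?_⟩
  · rcases eq_or_ne x 0 with rfl | hx
    · simp
    rcases eq_or_ne y 0 with rfl | hy
    · simp
    have hx' : ‖(‖x‖⁻¹ : ℂ) • x‖ = 1 := by
      rw [norm_smul]
      simp [hx]
    have hy' : ‖(‖y‖⁻¹ : ℂ) • y‖ = 1 := by
      rw [norm_smul]
      simp [hy]
    simp only [inner_smul_left (𝕜 := ℂ) (t _), inner_smul_right (𝕜 := ℂ) (t _), norm_mul,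
      hunit _ _ hx' hy']
    rw [inner_smul_left, inner_smul_right]
    simp only [norm_mul, map_inv₀, Complex.conj_ofReal, norm_inv, Complex.norm_real, norm_norm]
    have := norm_ne_zero_iff.2 hx
    have := norm_ne_zero_iff.2 hy
    field_simp
  · have h1 := hpres A ⟨_, isPositive_one_add_ketbra hy⟩
    rw [ht2 y hy] at h1
    simpa [hy] using h1

/-- The homomorphism `σ` covers the unitary and antiunitary cases at once: the argument uses only
that it fixes real scalars and that `U` preserves moduli of inner products. Subtracting the
divergences relative to `I` shows that `perspDiff f` of `A'` and of `U A U⁻¹` have the same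
quadratic form. -/
lemma eq_conj_of_fDiv_eq (hf : StrictConvexOn ℝ (Set.Ici 0) f) {σ σ' : ℂ →+* ℂ}
    [RingHomInvPair σ σ'] [RingHomInvPair σ' σ] (hσ : ∀ r : ℝ, σ r = r) (U : H ≃ₛₗᵢ[σ] H)
    {τ : H → H} (hτ : ∀ x y, ‖inner ℂ (τ x) (τ y)‖ = ‖inner ℂ x y‖)
    (hU : ∀ x, ∃ c : ℂ, ‖c‖ = 1 ∧ τ x = c • U x) {A A' : H →ₗ[ℂ] H} (hA : A.IsPositive)
    (hA' : A'.IsPositive) (hone : fDiv f A' 1 = fDiv f A 1)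
    (hfam : ∀ y, ‖y‖ = 1 →
      fDiv f A' (1 + ketbra (τ y) (τ y)) = fDiv f A (1 + ketbra y y)) (x : H) :
    A' x = U (A (U.symm x)) := by
  obtain ⟨e, α, hd⟩ := exists_diag hA
  obtain ⟨g, β, hd'⟩ := exists_diag hA'
  have hUinner : ∀ x y, ‖inner ℂ (U x) (U y)‖ = ‖inner ℂ x y‖ := fun x y => by
    obtain ⟨c, hc, hcx⟩ := hU x
    obtain ⟨d, hd, hdy⟩ := hU y
    rw [← hτ x y, hcx, hdy, inner_smul_left, inner_smul_right, norm_mul, norm_mul, Complex.norm_conj,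
      hc, hd, one_mul, one_mul]
  have hon : Orthonormal ℂ fun i => U (e i) := by
    refine ⟨fun i => by rw [U.norm_map, e.norm_eq_one], fun i j hij => ?_⟩
    change inner ℂ (U (e i)) (U (e j)) = 0
    rw [← norm_eq_zero, hUinner, e.inner_eq_zero hij, norm_zero]
  have hspan := hon.linearIndependent.span_eq_top_of_card_eq_finrank' (by simp)
  let b := OrthonormalBasis.mk hon hspan.ge
  have hb : ∀ i, b i = U (e i) := fun i => by simp [b]
  let C : H →ₗ[ℂ] H :=
    (U.toLinearEquiv : H →ₛₗ[σ] H).comp (A.comp (U.symm.toLinearEquiv : H →ₛₗ[σ'] H))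
  have hC : ∀ x, C x = U (A (U.symm x)) := fun x => rfl
  have hdC : Diag C b α := ⟨hd.nonneg, fun i => by
    rw [hC, hb, U.symm_apply_apply, hd.apply, map_smulₛₗ, hσ]⟩
  have hquad : ∀ y, ‖y‖ = 1 → ∑ i, perspDiff f (β i) * ‖inner ℂ (g i) (U y)‖ ^ 2 =
      ∑ i, perspDiff f (α i) * ‖inner ℂ (e i) y‖ ^ 2 := fun y hy => by
    obtain ⟨c, hc, hcy⟩ := hU y
    have hτy : ‖τ y‖ = 1 := by rw [hcy, norm_smul, hc, U.norm_map, hy, one_mul]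
    have h1 := hfam y hy
    rw [fDiv_one_add_ketbra hd' hτy, fDiv_one_add_ketbra hd hy] at h1
    rw [fDiv_one_right hd', fDiv_one_right hd] at hone
    have h2 := EReal.coe_injective h1
    rw [EReal.coe_injective hone, hcy] at h2
    simpa only [inner_smul_right, norm_mul, hc, one_mul] using add_left_cancel h2
  have hquad_all : ∀ y, ∑ i, perspDiff f (β i) * ‖inner ℂ (g i) (U y)‖ ^ 2 =
      ∑ i, perspDiff f (α i) * ‖inner ℂ (e i) y‖ ^ 2 := fun y => by
    rcases eq_or_ne y 0 with rfl | hy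
    · simp
    have hu : ‖(‖y‖⁻¹ : ℂ) • y‖ = 1 := by
      rw [norm_smul]
      simp [hy]
    have hyu : y = (‖y‖ : ℂ) • ((‖y‖⁻¹ : ℂ) • y) := by
      rw [smul_smul, mul_inv_cancel₀ (by simpa using hy), one_smul]
    generalize (‖y‖⁻¹ : ℂ) • y = u at hu hyu
    have h1 := congrArg (‖y‖ ^ 2 * ·) (hquad u hu)
    simp only [Finset.mul_sum] at h1
    rw [hyu, map_smulₛₗ, hσ]
    simp only [inner_smul_right, norm_mul, Complex.norm_real, norm_norm, mul_pow]
    convert h1 using 2 <;> ring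
  have hquad' : ∀ y : H,
      inner ℂ (opFun (perspDiff f) A' y) y = inner ℂ (opFun (perspDiff f) C y) y := by
    intro y
    rw [← inner_conj_symm, ← inner_conj_symm (opFun (perspDiff f) C y), inner_opFun_apply hd',
      inner_opFun_apply hdC]
    obtain ⟨z, rfl⟩ := U.surjective y
    simp only [hb, hUinner, hquad_all]
  have hAC : A' = C := by
    refine eq_of_opFun_eq (perspDiff_injOn hf) hA' hdC.isPositive ?_
    exact (ext_inner_map _ _).1 hquad'
  rw [hAC, hC]

end PreservingMaps

end QuantumFDiv

end

open QuantumFDiv in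
/-- A unitary operator is a complex-linear isometric bijection of `H`, an antiunitary one is a
conjugate-linear isometric bijection; in both cases `U* = U⁻¹`, which is `U.symm`. -/
theorem mainTheorem1 {H : Type*} [NormedAddCommGroup H] [InnerProductSpace ℂ H]
    [FiniteDimensional ℂ H] (f : ℝ → ℝ) (hf : StrictConvexOn ℝ (Set.Ici 0) f)
    (φ : QuantumFDiv.PSD H → QuantumFDiv.PSD H) (hφ : Function.Bijective φ)
    (hpres : ∀ A B : QuantumFDiv.PSD H,
      QuantumFDiv.fDiv f (φ A).1 (φ B).1 = QuantumFDiv.fDiv f A.1 B.1) :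
    (∃ U : H ≃ₗᵢ[ℂ] H, ∀ (A : QuantumFDiv.PSD H) (x : H), (φ A).1 x = U (A.1 (U.symm x))) ∨
    (∃ U : H ≃ₛₗᵢ[starRingEnd ℂ] H, ∀ (A : QuantumFDiv.PSD H) (x : H),
      (φ A).1 x = U (A.1 (U.symm x))) := by
  obtain ⟨τ, hτ, hfam⟩ := exists_wigner_map hf hφ hpres
  have hone : ∀ A : PSD H, fDiv f (φ A).1 1 = fDiv f A.1 1 := fun A => by
    have h1 := hpres A ⟨1, isPositive_one⟩
    rwa [map_one_eq hf hφ hpres] at h1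
  rcases wigner hτ with ⟨U, hU⟩ | ⟨U, hU⟩
  · exact Or.inl ⟨U, fun A x => eq_conj_of_fDiv_eq hf (fun _ => rfl) U hτ hU A.2 (φ A).2 (hone A)
      (hfam A) x⟩
  · exact Or.inr ⟨U, fun A x => eq_conj_of_fDiv_eq hf Complex.conj_ofReal U hτ hU A.2 (φ A).2
      (hone A) (hfam A) x⟩
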